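/- **Theorem 3.** *Setting.* For each $N$ let $\Gamma_N(k)=(\gamma_{ij}(k))_{1\le i,j\le N}$, $k\ge 1$, be random real symmetric $N\times N$ matrices forming a stationary Wigner process of variance $\beta^2$ and covariance function $r$. This means: - the processes $(\gamma_{ij}(k))_{k\ge1}$, $i\le j$, are independent of each other and centered; - for each $k\ge 1$ and each $p\ge 2$ the moments $\mathbb E|\gamma_{ij}(k)|^p$ are bounded uniformly in $i,j$ and $N$; - for $i\ne j$ one has $\mathbb E(\gamma_{ij}(k)^2)=\beta^2$ and $\mathbb E(\gamma_{ij}(k)\gamma_{ij}(m))=\beta^2 r(|k-m|)$, where $r(0)=1$ and $|r(|k-m|)|\le 1$ for all $k,m\ge1$. Let $D_N=\mathrm{diag}(\lambda_1,\dots,\lambda_N)$ be random diagonal matrices, independent of the Wigner process, whose entries are i.i.d. of a law $\mu$ on $\mathbb R$ with finite moments $\mu_k=\int x^k\,d\mu$ of all orders and $\mu_1=1$. For $k\ge0$ put $$Q_k^N=N^{-k/2}D_N\prod_{m=1}^k(\Gamma_N(m)D_N),\qquad B_k^N(r)=N^{-1}\,\mathbb E(\mathrm{tr}\,Q_k^N).$$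 Let $\mathcal F_n$ be the set of rooted plane trees with $n$ nodes and $|t|$ the number of nodes of $t$. For a tree $t$ whose root has the subtrees $t_1,\dots,t_d$ ($d\ge 0$) define recursively $$B^r(t)=B^r_{|t|}\prod_{i=1}^d B^r(t_i),\quad B^r_k=\beta^2 r(2k-1),\qquad \omega_\mu(t)=\mu_{d+1}\prod_{i=1}^d\omega_\mu(t_i).$$ Let $\psi_\mu(z)=\sum_{k\ge0}\mu_{k+1}z^k$ as a formal power series. *Claims.* 1. The means $B_k^N(r)$ exist. For every $k\ge0$, as $N\to\infty$, $B_{2k+1}^N(r)\to0$ and $$B_{2k}^N(r)\longrightarrow B_{2k}(r)=\sum_{t\in\mathcal F_{k+1}}\frac{B^r(t)}{B^r_{k+1}}\,\omega_\mu(t),$$ where the quotient $B^r(t)/B^r_{|t|}$ denotes $\prod_i B^r(t_i)$ (also if $B^r_{|t|}=0$). In particular $$B_{2k}(r)=\frac1{B^r_{k+1}}\sum_{t\in\mathcal F_{k+1}}B^r(t)\,\omega_\mu(t)\qquad\text{if } B^r_{k+1}\neq0.$$ 2. The formal power series $Y(z)=\sum_{k\ge1}z^kB^r_kB_{2(k-1)}(r)$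 satisfies $$\sum_{k\ge1}z^kB_{2(k-1)}(r)=z\,\psi_\mu(Y(z)).$$ 3. If $L^r(z)=\sum_{m\ge0}L_mz^m$ is a real power series which converges at every integer $k\ge1$, with $B^r_k=L^r(k)/k$ for all $k\ge1$, then $$Y'=L^r(\theta+1)\,\psi_\mu(Y),$$ where $\theta=z\frac{d}{dz}$ and $L^r(\theta+1)F=\sum_{m\ge0}L_m(\theta+1)^mF$; for $F=\psi_\mu(Y)$ this last series converges coefficient by coefficient. -/

import Mathlib

open MeasureTheory ProbabilityTheory Filter Topology

/-! ### Rooted plane trees and bare Green functions -/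

/-- Rooted plane trees: a root together with a linearly ordered finite family of `k` subtrees,
listed from `0` to `k - 1`; `k` is the outdegree of the root. -/
inductive PlaneTree : Type where
  | node (k : ℕ) (child : Fin k → PlaneTree) : PlaneTree

namespace PlaneTree

/-- The number of nodes `|t|` (also called the order of `t`). -/
def order : PlaneTree → ℕ
  | node _ c => 1 + ∑ i, (c i).order

/-- The weight `ω(t)` of a tree for the weight sequence `ψ`:
`ω(t) = ψ_k ∏ ω(t_i)`, where `t_1, …, t_k` are the subtrees of the root. -/
def weight (ψ : ℕ → ℝ) : PlaneTree → ℝ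
  | node k c => ψ k * ∏ i, (c i).weight ψ

/-- The bare Green function associated with the sequence `b`:
`B(t) = b_{|t|} ∏ B(t_i)`. -/
def bare (b : ℕ → ℝ) : PlaneTree → ℝ
  | node k c => b (node k c).order * ∏ i, (c i).bare b

/-- The quotient `B(t) / b_{|t|}`, that is, the product of the values of `B` at the subtrees of
the root; this keeps its meaning when `b_{|t|} = 0`. -/
def bareQuot (b : ℕ → ℝ) : PlaneTree → ℝ
  | node _ c => ∏ i, (c i).bare b

theorem bare_eq (b : ℕ → ℝ) (t : PlaneTree) : t.bare b = b t.order * t.bareQuot b := by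
  cases t
  rfl

theorem finite_order_le (n : ℕ) : {t : PlaneTree | t.order ≤ n}.Finite := by
  induction n with
  | zero =>
    refine Set.Finite.subset Set.finite_empty ?_
    rintro ⟨k, c⟩ h
    simp [order] at h
  | succ n ih =>
    have hfin : (⋃ k ∈ Set.Iic n, node k ''
        Set.pi Set.univ (fun _ : Fin k => {t : PlaneTree | t.order ≤ n})).Finite :=
      (Set.finite_Iic n).biUnion fun k _ => (Set.Finite.pi' fun _ => ih).image _ |>.subset
        (Set.image_mono fun f hf i => hf i (Set.mem_univ i))
    refine hfin.subset ?_
    rintro ⟨k, c⟩ h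
    have hpos : ∀ t : PlaneTree, 1 ≤ t.order := by
      rintro ⟨k, c⟩
      simp [order]
    have h' : ∑ i, (c i).order ≤ n := by
      have : 1 + ∑ i, (c i).order ≤ n + 1 := h
      omega
    simp only [Set.mem_iUnion]
    refine ⟨k, ?_, c, fun i _ => ?_, rfl⟩
    · calc k = ∑ _i : Fin k, 1 := by simp
        _ ≤ ∑ i, (c i).order := Finset.sum_le_sum fun i _ => hpos _
        _ ≤ n := h'
    · exact (Finset.single_le_sum (f := fun i => (c i).order)
        (fun _ _ => Nat.zero_le _) (Finset.mem_univ i)).trans h'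

theorem finite_order_eq (n : ℕ) : {t : PlaneTree | t.order = n}.Finite :=
  (finite_order_le n).subset fun _ h => le_of_eq h

/-- The finite set of the rooted plane trees with `n` nodes. -/
noncomputable def ofOrder (n : ℕ) : Finset PlaneTree := (finite_order_eq n).toFinset

theorem mem_ofOrder {n : ℕ} {t : PlaneTree} : t ∈ ofOrder n ↔ t.order = n := by
  simp [ofOrder]

end PlaneTree

/-! ### Wigner matrices and Wigner processes

The matrices of dimension `N` live on a probability space `(Ω N, P N)` which may depend on `N`. -/

/-- `G N` is, for each `N`, an `N`-dimensional random matrix; the sequence consists of Wigner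
matrices of variance `β²`. The moment bounds are uniform in the entries and in `N`. -/
structure IsWignerMatrix {Ω : ℕ → Type*} [∀ N, MeasurableSpace (Ω N)]
    (P : ∀ N, Measure (Ω N)) (β : ℝ) (G : ∀ N, Ω N → Matrix (Fin N) (Fin N) ℝ) : Prop where
  measurable : ∀ N i j, Measurable fun ω => G N ω i j
  symmetric : ∀ N ω i j, G N ω i j = G N ω j i
  indep : ∀ N, iIndepFun
    (fun (p : {p : Fin N × Fin N // p.1 ≤ p.2}) ω => G N ω p.1.1 p.1.2) (P N)
  centered : ∀ N i j, ∫ ω, G N ω i j ∂(P N) = 0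
  variance : ∀ N i j, i ≠ j → ∫ ω, (G N ω i j) ^ 2 ∂(P N) = β ^ 2
  moments : ∃ c : ℕ → ℝ, ∀ k, 2 ≤ k → ∀ N i j,
    Integrable (fun ω => |G N ω i j| ^ k) (P N) ∧ ∫ ω, |G N ω i j| ^ k ∂(P N) ≤ c k

/-- The conditions on the correlation function of a Wigner process. -/
structure IsCorrelation (R : ℕ+ → ℕ+ → ℝ) : Prop where
  diag : ∀ k, R k k = 1
  abs_le : ∀ k m, |R k m| ≤ 1
  symmetric : ∀ k m, R k m = R m k

/-- `Γ N k`, `k ≥ 1`, is a Wigner process of variance `β²` and correlation function `R`. -/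
structure IsWignerProcess {Ω : ℕ → Type*} [∀ N, MeasurableSpace (Ω N)]
    (P : ∀ N, Measure (Ω N)) (β : ℝ) (R : ℕ+ → ℕ+ → ℝ)
    (Γ : ∀ N, ℕ+ → Ω N → Matrix (Fin N) (Fin N) ℝ) : Prop where
  correlation : IsCorrelation R
  wigner : ∀ k, IsWignerMatrix P β fun N => Γ N k
  indep : ∀ N, iIndepFun
    (fun (p : {p : Fin N × Fin N // p.1 ≤ p.2}) ω (k : ℕ+) => Γ N k ω p.1.1 p.1.2) (P N)
  correlated : ∀ N i j, i ≠ j → ∀ k m : ℕ+, m ≤ k →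
    ∫ ω, Γ N k ω i j * Γ N m ω i j ∂(P N) = β ^ 2 * R k m

/-- The correlation function `R` is stationary: `R(k, m) = r(|k - m|)`. -/
def IsStationaryCorrelation (R : ℕ+ → ℕ+ → ℝ) (r : ℕ → ℝ) : Prop :=
  ∀ k m : ℕ+, R k m = r ((k : ℤ) - (m : ℤ)).natAbs

/-- `lam N j`, `j < N`, are the diagonal entries of a random diagonal matrix of dimension `N`;
they are independent with common law `μ`. -/
structure IsIIDDiagonal {Ω : ℕ → Type*} [∀ N, MeasurableSpace (Ω N)]
    (P : ∀ N, Measure (Ω N)) (μ : Measure ℝ) (lam : ∀ N, Fin N → Ω N → ℝ) : Prop where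
  law : ∀ N j, HasLaw (lam N j) μ (P N)
  indep : ∀ N, iIndepFun (lam N) (P N)

/-- `Q_k^N = N^{-k/2} D ∏_{m=1}^k (Γ(m) D)` (ordered product) for deterministic matrices, where
`D` is the diagonal matrix with entries `d`. -/
noncomputable def wignerProduct {N : ℕ} (Γ : ℕ+ → Matrix (Fin N) (Fin N) ℝ) (d : Fin N → ℝ)
    (k : ℕ) : Matrix (Fin N) (Fin N) ℝ :=
  ((N : ℝ) ^ (-(k : ℝ) / 2)) •
    (Matrix.diagonal d *
      ((List.range k).map fun m => Γ m.succPNat * Matrix.diagonal d).prod)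

/-- The mean normalized trace `B_k^N = N⁻¹ E(tr(Q_k^N))`. -/
noncomputable def meanTrace {N : ℕ} {Ω : Type*} [MeasurableSpace Ω] (P : Measure Ω)
    (Γ : ℕ+ → Ω → Matrix (Fin N) (Fin N) ℝ) (lam : Fin N → Ω → ℝ) (k : ℕ) : ℝ :=
  (N : ℝ)⁻¹ * ∫ ω, (wignerProduct (fun m => Γ m ω) (fun j => lam j ω) k).trace ∂P

/-! ### The limit -/

/-- The sequence `B^r_k = β² r(2k - 1)`, used for `k ≥ 1` only. -/
noncomputable def wignerWeight (β : ℝ) (r : ℕ → ℝ) (k : ℕ) : ℝ := β ^ 2 * r (2 * k - 1)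

/-- The weight sequence `ψ_k = μ_{k+1}`. -/
noncomputable def momentWeight (μ : Measure ℝ) (k : ℕ) : ℝ := ∫ x, x ^ (k + 1) ∂μ

/-- `B_{2k}(r)`: the sum over the rooted plane trees `t` with `k + 1` nodes of
`(B^r(t) / B^r_{k+1}) ω_μ(t)`. -/
noncomputable def limitMoment (β : ℝ) (r : ℕ → ℝ) (μ : Measure ℝ) (k : ℕ) : ℝ :=
  ∑ t ∈ PlaneTree.ofOrder (k + 1),
    t.bareQuot (wignerWeight β r) * t.weight (momentWeight μ)

/-! ### Formal power series -/

/-- Euler's operator `θ = z d/dz` on formal power series. -/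
noncomputable def eulerOp : Module.End ℝ (PowerSeries ℝ) :=
  LinearMap.mulLeft ℝ PowerSeries.X ∘ₗ (PowerSeries.derivative ℝ).toLinearMap

/-- The `m`-th term `L_m (θ + 1)^m F` of `L(θ + 1) F`. -/
noncomputable def eulerTerm (L F : PowerSeries ℝ) (m : ℕ) : PowerSeries ℝ :=
  PowerSeries.coeff m L • ((eulerOp + 1) ^ m) F

/-- `L(θ + 1) F = ∑_m L_m (θ + 1)^m F`, where the series is summed coefficient by coefficient. -/
noncomputable def eulerSeries (L F : PowerSeries ℝ) : PowerSeries ℝ :=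
  PowerSeries.mk fun n => ∑' m, PowerSeries.coeff n (eulerTerm L F m)

/-! The trace expands into closed walks of length k on the complete graph (loops included) with N
vertices. By independence the expected weight of a walk factorizes: a vertex visited c times
contributes μ_c, and an edge contributes the joint moment of its entries at the times of traversal
(`integral_pathWeight`). An edge traversed exactly once contributes 0, because the entries are
centered.

Put h = √N and let s be the number of edges traversed exactly once so far. A step to a new vertex
has at most h² choices and raises s; a step to an old vertex has boundedly many choices and lowers s
by at most one. Since s must end at 0, all continuations by m steps together are O(h^(m-s))
(`abs_walkSum_mul_le`). For a walk around a plane tree only two kinds of steps keep this order: to a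
new vertex, or back to the parent. Every other step costs a factor h. Hence, up to a relative error
1/h, the walk sums obey the recursion of `contourSum` (`abs_walkSum_sub_contourSum_le`).

A subtree with j nodes is explored in 2j - 2 steps, so the edge above it is traversed at two times
which differ by 2j - 1: this is the source of B^r_j = β² r(2j - 1). A node with d children is
visited d + 1 times, which gives μ_{d+1}. The first return decomposition of contour walks and the
cutting of trees at the root both lead to the coefficients of ψ(Y), so the limit is the tree sum
(`contourSum_eq_limitMoment`); contour walks of odd length do not exist.

Y itself is the generating function of the trees with weight B(t) ω(t), and cutting at the root
gives its functional equation. Since θ + 1 multiplies the coefficient of z^n by n + 1, the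
differential equation is verified coefficient by coefficient (`generating_functions`). -/

/-! ### The generating function of weighted plane trees -/

namespace PlaneTree

theorem order_pos (t : PlaneTree) : 1 ≤ t.order := by
  cases t
  simp [order]

/-- The finite set of the rooted plane trees with at most `n` nodes. -/
noncomputable def ofOrderLE (n : ℕ) : Finset PlaneTree := (finite_order_le n).toFinset

theorem mem_ofOrderLE {n : ℕ} {t : PlaneTree} : t ∈ ofOrderLE n ↔ t.order ≤ n := by
  simp [ofOrderLE]

/-- The generating function `∑_t B(t) ω(t) z^{|t|}`. -/
noncomputable def genSeries (b ψ : ℕ → ℝ) : PowerSeries ℝ :=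
  PowerSeries.mk fun n => ∑ t ∈ ofOrder n, t.bare b * t.weight ψ

theorem coeff_genSeries_pow (b ψ : ℕ → ℝ) (d k : ℕ) :
    PowerSeries.coeff k (genSeries b ψ ^ d) =
      ∑ c ∈ (Fintype.piFinset fun _ : Fin d => ofOrderLE k) with ∑ i, (c i).order = k,
        ∏ i, (c i).bare b * (c i).weight ψ := by
  -- Trees with more than k nodes do not affect the k-th coefficient, so the series may be replaced
  -- by a finite sum of monomials, whose d-th power expands over d-tuples of trees.
  set p : PowerSeries ℝ :=
    ∑ t ∈ ofOrderLE k, PowerSeries.monomial t.order (t.bare b * t.weight ψ) with hp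
  have hdvd : (PowerSeries.X : PowerSeries ℝ) ^ (k + 1) ∣ genSeries b ψ - p := by
    rw [PowerSeries.X_pow_dvd_iff]
    intro m hm
    simp only [hp, map_sub, map_sum, genSeries, PowerSeries.coeff_mk, PowerSeries.coeff_monomial]
    rw [sub_eq_zero, ← Finset.sum_filter]
    refine Finset.sum_congr ?_ fun _ _ => rfl
    ext t
    simp only [mem_ofOrder, Finset.mem_filter, mem_ofOrderLE]
    omega
  have hpow : PowerSeries.coeff k (genSeries b ψ ^ d) = PowerSeries.coeff k (p ^ d) := by
    have h := hdvd.trans (sub_dvd_pow_sub_pow (genSeries b ψ) p d)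
    rw [PowerSeries.X_pow_dvd_iff] at h
    simpa [sub_eq_zero] using h k (Nat.lt_succ_self k)
  have hprod : ∀ c : Fin d → PlaneTree,
      ∏ i, PowerSeries.monomial (c i).order ((c i).bare b * (c i).weight ψ) =
        PowerSeries.monomial (∑ i, (c i).order) (∏ i, (c i).bare b * (c i).weight ψ) := by
    intro c
    induction (Finset.univ : Finset (Fin d)) using Finset.induction_on with
    | empty => simp
    | insert a s ha ih =>
      simp only [Finset.prod_insert ha, Finset.sum_insert ha, ih,
        PowerSeries.monomial_mul_monomial]
  have hexp : p ^ d = ∏ _i : Fin d, p := by simp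
  rw [hpow, hexp, hp, Finset.prod_univ_sum, map_sum, Finset.sum_filter]
  refine Finset.sum_congr rfl fun c _ => ?_
  rw [hprod, PowerSeries.coeff_monomial]
  simp only [eq_comm]

/-- The sum over the trees with `k + 1` nodes, sorted by the outdegree of the root. -/
theorem sum_ofOrder_succ (b ψ : ℕ → ℝ) (k : ℕ) :
    ∑ t ∈ ofOrder (k + 1), t.bareQuot b * t.weight ψ =
      ∑ d ∈ Finset.range (k + 1), ψ d * PowerSeries.coeff k (genSeries b ψ ^ d) := by
  simp only [coeff_genSeries_pow, Finset.mul_sum]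
  rw [Finset.sum_sigma']
  symm
  refine Finset.sum_bij (fun x _ => node x.1 x.2) ?_ ?_ ?_ ?_
  · rintro ⟨d, c⟩ h
    simp only [Finset.mem_sigma, Finset.mem_filter] at h
    rw [mem_ofOrder, order, h.2.2, add_comm]
  · rintro ⟨d, c⟩ _ ⟨d', c'⟩ _ h
    cases h
    rfl
  · rintro ⟨d, c⟩ h
    rw [mem_ofOrder, order] at h
    have hk : ∑ i, (c i).order = k := by omega
    refine ⟨⟨d, c⟩, ?_, rfl⟩
    simp only [Finset.mem_sigma, Finset.mem_filter, Finset.mem_range, Fintype.mem_piFinset,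
      mem_ofOrderLE]
    -- Every subtree has at least one node, so the outdegree of the root is at most k.
    refine ⟨?_, fun i => ?_, hk⟩
    · have : ∑ _i : Fin d, 1 ≤ ∑ i, (c i).order := Finset.sum_le_sum fun i _ => order_pos _
      simp at this
      omega
    · rw [← hk]
      exact Finset.single_le_sum (f := fun i => (c i).order) (fun _ _ => Nat.zero_le _)
        (Finset.mem_univ i)
  · rintro ⟨d, c⟩ _
    simp only [bareQuot, weight, Finset.prod_mul_distrib]
    ring

theorem coeff_zero_genSeries (b ψ : ℕ → ℝ) : PowerSeries.coeff 0 (genSeries b ψ) = 0 := by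
  rw [genSeries, PowerSeries.coeff_mk]
  refine Finset.sum_eq_zero fun t ht => ?_
  have := order_pos t
  rw [mem_ofOrder] at ht
  omega

theorem coeff_succ_genSeries (b ψ : ℕ → ℝ) (k : ℕ) :
    PowerSeries.coeff (k + 1) (genSeries b ψ) =
      b (k + 1) * ∑ t ∈ ofOrder (k + 1), t.bareQuot b * t.weight ψ := by
  rw [genSeries, PowerSeries.coeff_mk, Finset.mul_sum]
  refine Finset.sum_congr rfl fun t ht => ?_
  rw [bare_eq, mem_ofOrder.1 ht, mul_assoc]

end PlaneTree

/-! ### Coefficients of substituted series and of Euler's operator. -/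

namespace PowerSeries

theorem coeff_pow_eq_zero_of_lt {Y : PowerSeries ℝ} (hY : coeff 0 Y = 0) {n d : ℕ} (h : n < d) :
    coeff n (Y ^ d) = 0 := by
  have hX : (X : PowerSeries ℝ) ∣ Y := by
    rw [X_dvd_iff, ← coeff_zero_eq_constantCoeff_apply, hY]
  exact (X_pow_dvd_iff.1 (pow_dvd_pow_of_dvd hX d)) n h

/-- The coefficients of `∑_d a_d Y^d` for a series `Y` without constant term. -/
theorem coeff_subst_eq_sum_range {Y : PowerSeries ℝ} (hY : coeff 0 Y = 0) (ψ : PowerSeries ℝ)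
    {n M : ℕ} (hM : n < M) :
    coeff n (subst Y ψ) = ∑ d ∈ Finset.range M, coeff d ψ * coeff n (Y ^ d) := by
  rw [coeff_subst' (HasSubst.of_constantCoeff_zero'
    (by rw [← coeff_zero_eq_constantCoeff_apply, hY]))]
  rw [finsum_eq_sum_of_support_subset]
  · rfl
  · intro d hd
    simp only [Finset.coe_range, Set.mem_Iio]
    by_contra hlt
    exact hd (by simp [coeff_pow_eq_zero_of_lt hY (show n < d by omega)])

/-- θ + 1 acts diagonally: z^n is an eigenvector with eigenvalue n + 1. -/
theorem coeff_eulerOp_add_one_pow (F : PowerSeries ℝ) (m n : ℕ) :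
    coeff n (((eulerOp + 1) ^ m) F) = ((n : ℝ) + 1) ^ m * coeff n F := by
  have h1 : ∀ G : PowerSeries ℝ, coeff n ((eulerOp + 1) G) = ((n : ℝ) + 1) * coeff n G := by
    intro G
    simp only [eulerOp, LinearMap.add_apply, LinearMap.comp_apply, LinearMap.mulLeft_apply,
      Module.End.one_apply, map_add]
    cases n with
    | zero => simp
    | succ n =>
      rw [coeff_succ_X_mul]
      change coeff n (derivative ℝ G) + _ = _
      rw [coeff_derivative]
      push_cast
      ring
  induction m with
  | zero => simp
  | succ m ih =>
    rw [pow_succ', Module.End.mul_apply, h1, ih, pow_succ]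
    ring

theorem coeff_eulerTerm (L F : PowerSeries ℝ) (m n : ℕ) :
    coeff n (eulerTerm L F m) = coeff m L * ((n : ℝ) + 1) ^ m * coeff n F := by
  rw [eulerTerm, coeff_smul, coeff_eulerOp_add_one_pow, smul_eq_mul, mul_assoc]

end PowerSeries

theorem limitMoment_eq_coeff_subst (β : ℝ) (r : ℕ → ℝ) (μ : Measure ℝ) (k : ℕ) :
    limitMoment β r μ k = PowerSeries.coeff k
      (PowerSeries.subst (PlaneTree.genSeries (wignerWeight β r) (momentWeight μ))
        (PowerSeries.mk (momentWeight μ))) := by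
  rw [PowerSeries.coeff_subst_eq_sum_range (PlaneTree.coeff_zero_genSeries _ _) _
    (Nat.lt_succ_self k), limitMoment, PlaneTree.sum_ofOrder_succ]
  simp

/-- Identifies the series Y built from the limit moments with the generating function of trees,
which makes the equation for Y self-consistent. -/
theorem genSeries_eq_X_mul (β : ℝ) (r : ℕ → ℝ) (μ : Measure ℝ) :
    PlaneTree.genSeries (wignerWeight β r) (momentWeight μ) = PowerSeries.X * PowerSeries.mk
      (fun k => wignerWeight β r (k + 1) * limitMoment β r μ k) := by
  ext n
  cases n with
  | zero => simp [PlaneTree.coeff_zero_genSeries]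
  | succ n =>
    rw [PlaneTree.coeff_succ_genSeries, PowerSeries.coeff_succ_X_mul, PowerSeries.coeff_mk]
    rfl

theorem generating_functions (β : ℝ) (r : ℕ → ℝ) (μ : Measure ℝ) (Y ψ : PowerSeries ℝ)
    (hY : Y = PowerSeries.X * PowerSeries.mk
      (fun k => wignerWeight β r (k + 1) * limitMoment β r μ k))
    (hψ : ψ = PowerSeries.mk (momentWeight μ)) :
    PowerSeries.HasSubst Y ∧
      PowerSeries.X * PowerSeries.mk (limitMoment β r μ) =
        PowerSeries.X * PowerSeries.subst Y ψ ∧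
      ∀ L : PowerSeries ℝ,
        (∀ k : ℕ, 1 ≤ k → HasSum (fun m => PowerSeries.coeff m L * (k : ℝ) ^ m)
          ((k : ℝ) * wignerWeight β r k)) →
        (∀ n, Summable fun m => PowerSeries.coeff n (eulerTerm L (PowerSeries.subst Y ψ) m)) ∧
        PowerSeries.derivative ℝ Y = eulerSeries L (PowerSeries.subst Y ψ) := by
  have hsub : PowerSeries.mk (limitMoment β r μ) = PowerSeries.subst Y ψ := by
    ext k
    rw [PowerSeries.coeff_mk, limitMoment_eq_coeff_subst, genSeries_eq_X_mul, ← hY, ← hψ]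
  refine ⟨PowerSeries.HasSubst.of_constantCoeff_zero' (by simp [hY]), by rw [hsub], ?_⟩
  intro L hL
  -- The hypothesis on L at k = n + 1, multiplied by B_{2n}, sums the n-th coefficients; the value
  -- (n + 1) B^r_{n+1} B_{2n} is the n-th coefficient of Y'.
  have hterm : ∀ n, HasSum (fun m => PowerSeries.coeff n (eulerTerm L (PowerSeries.subst Y ψ) m))
      ((((n + 1 : ℕ) : ℝ) * wignerWeight β r (n + 1)) * limitMoment β r μ n) := by
    intro n
    have h := (hL (n + 1) (by omega)).mul_right (limitMoment β r μ n)
    have hm : (fun m => PowerSeries.coeff n (eulerTerm L (PowerSeries.subst Y ψ) m)) =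
        fun m => PowerSeries.coeff m L * ((n + 1 : ℕ) : ℝ) ^ m * limitMoment β r μ n := by
      funext m
      rw [PowerSeries.coeff_eulerTerm, ← hsub, PowerSeries.coeff_mk]
      push_cast
      rfl
    rw [hm]
    exact h
  refine ⟨fun n => (hterm n).summable, ?_⟩
  ext n
  rw [eulerSeries, PowerSeries.coeff_mk, (hterm n).tsum_eq, PowerSeries.coeff_derivative, hY,
    PowerSeries.coeff_succ_X_mul, PowerSeries.coeff_mk]
  push_cast
  ring

/-! ### Weighted contour walks of plane trees -/

/-- The total weight of the ways to complete the contour walk of a plane tree in `m` steps. The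
walk has made `t` steps, it has visited the current node `c` times, and the list contains, for the
current node and each of its ancestors other than the root, the time of the step to it and the
number of visits of its parent. A node with `c` visits has weight `mom c`, an edge traversed at
times `o < t` has weight `ρ (t - o)`. -/
def contourSum (mom ρ : ℕ → ℝ) : ℕ → ℕ → ℕ → List (ℕ × ℕ) → ℝ
  | 0, _, c, [] => mom c
  | 0, _, _, _ :: _ => 0
  | m + 1, t, c, [] => contourSum mom ρ m (t + 1) 1 [(t, c)]
  | m + 1, t, c, (o, c') :: L => contourSum mom ρ m (t + 1) 1 ((t, c) :: (o, c') :: L) +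
      mom c * ρ (t - o) * contourSum mom ρ m (t + 1) (c' + 1) L

/-- The part of `contourSum` which belongs to the walks that leave the current node at once
towards its parent; the weight of the current node is omitted. -/
def contourReturn (mom ρ : ℕ → ℝ) : ℕ → ℕ → List (ℕ × ℕ) → ℝ
  | 0, _, [] => 1
  | 0, _, _ :: _ => 0
  | _ + 1, _, [] => 0
  | m + 1, t, (o, c') :: L => ρ (t - o) * contourSum mom ρ m (t + 1) (c' + 1) L

theorem contourReturn_zero_cons (mom ρ : ℕ → ℝ) (t : ℕ) (s : ℕ × ℕ) (L : List (ℕ × ℕ)) :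
    contourReturn mom ρ 0 t (s :: L) = 0 := rfl

theorem contourReturn_succ_cons (mom ρ : ℕ → ℝ) (m t o c' : ℕ) (L : List (ℕ × ℕ)) :
    contourReturn mom ρ (m + 1) t ((o, c') :: L) =
      ρ (t - o) * contourSum mom ρ m (t + 1) (c' + 1) L := rfl

theorem contourSum_zero (mom ρ : ℕ → ℝ) (t c : ℕ) (L : List (ℕ × ℕ)) :
    contourSum mom ρ 0 t c L = mom c * contourReturn mom ρ 0 t L := by
  cases L <;> simp [contourSum, contourReturn]

theorem contourSum_succ (mom ρ : ℕ → ℝ) (m t c : ℕ) (L : List (ℕ × ℕ)) :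
    contourSum mom ρ (m + 1) t c L = contourSum mom ρ m (t + 1) 1 ((t, c) :: L) +
      mom c * contourReturn mom ρ (m + 1) t L := by
  cases L <;> simp [contourSum, contourReturn, mul_assoc]

theorem sum_antidiagonal_assoc (f : ℕ → ℕ → ℕ → ℝ) (n : ℕ) :
    ∑ p ∈ Finset.HasAntidiagonal.antidiagonal n, ∑ q ∈ Finset.HasAntidiagonal.antidiagonal p.2,
        f p.1 q.1 q.2 =
      ∑ p ∈ Finset.HasAntidiagonal.antidiagonal n, ∑ q ∈ Finset.HasAntidiagonal.antidiagonal p.1,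
        f q.1 q.2 p.2 := by
  rw [Finset.sum_sigma', Finset.sum_sigma']
  refine Finset.sum_nbij' (fun x => ⟨(x.1.1 + x.2.1, x.2.2), (x.1.1, x.2.1)⟩)
    (fun x => ⟨(x.2.1, x.2.2 + x.1.2), (x.2.2, x.1.2)⟩) ?_ ?_ ?_ ?_ ?_
  · rintro ⟨⟨a, b⟩, x, y⟩ h
    simp only [Finset.mem_sigma, Finset.HasAntidiagonal.mem_antidiagonal] at h ⊢
    refine ⟨by omega, ?_⟩
    trivial
  · rintro ⟨⟨a, b⟩, x, y⟩ h
    simp only [Finset.mem_sigma, Finset.HasAntidiagonal.mem_antidiagonal] at h ⊢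
    refine ⟨by omega, ?_⟩
    trivial
  · rintro ⟨⟨a, b⟩, x, y⟩ h
    simp only [Finset.mem_sigma, Finset.HasAntidiagonal.mem_antidiagonal] at h
    obtain ⟨h1, rfl⟩ := h
    rfl
  · rintro ⟨⟨a, b⟩, x, y⟩ h
    simp only [Finset.mem_sigma, Finset.HasAntidiagonal.mem_antidiagonal] at h
    obtain ⟨h1, rfl⟩ := h
    rfl
  · intro _ _
    rfl

/-- First return decomposition of contour walks: if `n A c` satisfies the recursion of the total
weight of the excursions of length `A` from a node with `c` visits, then it is this weight. -/
theorem contourSum_eq_sum_antidiagonal (mom ρ : ℕ → ℝ) (n : ℕ → ℕ → ℝ)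
    (h0 : ∀ c, n 0 c = mom c) (h1 : ∀ c, n 1 c = 0)
    (h2 : ∀ A c, n (A + 2) c =
      ∑ p ∈ Finset.HasAntidiagonal.antidiagonal A,
        n p.1 1 * ρ (p.1 + 1) * n p.2 (c + 1)) (m : ℕ) :
    ∀ t c L, contourSum mom ρ m t c L =
      ∑ p ∈ Finset.HasAntidiagonal.antidiagonal m,
        n p.1 c * contourReturn mom ρ p.2 (t + p.1) L := by
  induction m using Nat.strong_induction_on with
  | _ m ih =>
    intro t c L
    match m with
    | 0 => simp [contourSum_zero, h0]
    | 1 => simp [contourSum_succ, contourSum_zero, contourReturn,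
        Finset.Nat.sum_antidiagonal_succ, h0, h1]
    | m + 2 =>
      -- The excursion of length 0 matches the immediate return, and length 1 is impossible. A child
      -- excursion that uses up all remaining steps leaves a non-empty stack and drops out.
      rw [contourSum_succ, Finset.Nat.sum_antidiagonal_succ, Finset.Nat.sum_antidiagonal_succ,
        ih (m + 1) (by omega), Finset.Nat.sum_antidiagonal_succ']
      simp only [h0, h1, contourReturn_zero_cons, contourReturn_succ_cons, zero_add, add_zero,
        mul_zero, zero_mul]
      rw [add_comm]
      congr 1
      calc ∑ p ∈ Finset.HasAntidiagonal.antidiagonal m, n p.1 1 *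
            (ρ (t + 1 + p.1 - t) * contourSum mom ρ p.2 (t + 1 + p.1 + 1) (c + 1) L)
          = ∑ p ∈ Finset.HasAntidiagonal.antidiagonal m,
              ∑ q ∈ Finset.HasAntidiagonal.antidiagonal p.2,
              n p.1 1 * ρ (p.1 + 1) * n q.1 (c + 1) *
                contourReturn mom ρ q.2 (t + (p.1 + q.1 + 2)) L := by
            -- The child excursion starts at time t + 1 and takes p.1 steps, so its edge is closed
            -- after a gap of p.1 + 1. What follows the return is decomposed once more.
            refine Finset.sum_congr rfl fun p hp => ?_
            rw [Finset.HasAntidiagonal.mem_antidiagonal] at hp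
            rw [ih p.2 (by omega), Finset.mul_sum, Finset.mul_sum]
            refine Finset.sum_congr rfl fun q _ => ?_
            rw [show t + 1 + p.1 - t = p.1 + 1 by omega,
              show t + 1 + p.1 + 1 + q.1 = t + (p.1 + q.1 + 2) by omega]
            ring
        _ = ∑ p ∈ Finset.HasAntidiagonal.antidiagonal m,
              ∑ q ∈ Finset.HasAntidiagonal.antidiagonal p.1,
              n q.1 1 * ρ (q.1 + 1) * n q.2 (c + 1) *
                contourReturn mom ρ p.2 (t + (q.1 + q.2 + 2)) L :=
            sum_antidiagonal_assoc (fun a x y => n a 1 * ρ (a + 1) * n x (c + 1) *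
                contourReturn mom ρ y (t + (a + x + 2)) L) m
        _ = _ := by
            refine Finset.sum_congr rfl fun p _ => ?_
            rw [show p.1 + 1 + 1 = p.1 + 2 from rfl, h2, Finset.sum_mul]
            refine Finset.sum_congr rfl fun q hq => ?_
            rw [Finset.HasAntidiagonal.mem_antidiagonal.1 hq]

theorem sum_antidiagonal_two_mul (f : ℕ → ℕ → ℝ) (n : ℕ)
    (hf : ∀ a b, ¬ Even a → f a b = 0) :
    ∑ p ∈ Finset.HasAntidiagonal.antidiagonal (2 * n), f p.1 p.2 =
      ∑ p ∈ Finset.HasAntidiagonal.antidiagonal n, f (2 * p.1) (2 * p.2) := by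
  symm
  refine Finset.sum_of_injOn (fun p => (2 * p.1, 2 * p.2)) ?_ ?_ ?_ ?_
  · rintro ⟨a, b⟩ _ ⟨a', b'⟩ _ h
    simp only [Prod.mk.injEq] at h ⊢
    omega
  · rintro ⟨a, b⟩ h
    simp only [Finset.mem_coe, Finset.HasAntidiagonal.mem_antidiagonal] at h ⊢
    omega
  · rintro ⟨a, b⟩ h h'
    refine hf a b fun ⟨j, hj⟩ => h' ⟨(j, n - j), ?_, ?_⟩
    · simp only [Finset.HasAntidiagonal.mem_antidiagonal, Finset.mem_coe] at h ⊢
      omega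
    · simp only [Finset.HasAntidiagonal.mem_antidiagonal, Prod.mk.injEq] at h ⊢
      omega
  · intro _ _
    rfl

/-- Compares coefficients in Σ_d mom(d+c) Y^d = mom(c) + Y Σ_d mom(d+c+1) Y^d: a node with c visits
either has no further child, or has a first one and is then visited again. -/
theorem coeff_succ_subst_shift (mom : ℕ → ℝ) {Y : PowerSeries ℝ}
    (hY : PowerSeries.coeff 0 Y = 0) (c n : ℕ) :
    PowerSeries.coeff (n + 1) (PowerSeries.subst Y (PowerSeries.mk fun d => mom (d + c))) =
      ∑ p ∈ Finset.HasAntidiagonal.antidiagonal n, PowerSeries.coeff (p.1 + 1) Y *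
        PowerSeries.coeff p.2 (PowerSeries.subst Y (PowerSeries.mk fun d => mom (d + (c + 1)))) := by
  rw [PowerSeries.coeff_subst_eq_sum_range hY _ (show n + 1 < n + 2 by omega),
    Finset.sum_range_succ']
  have h0 : PowerSeries.coeff (n + 1) (Y ^ 0) = 0 := by simp [PowerSeries.coeff_one]
  rw [h0, mul_zero, add_zero]
  have hR : ∀ p ∈ Finset.HasAntidiagonal.antidiagonal n,
      PowerSeries.coeff p.2 (PowerSeries.subst Y (PowerSeries.mk fun d => mom (d + (c + 1)))) =
        ∑ d ∈ Finset.range (n + 1), mom (d + (c + 1)) * PowerSeries.coeff p.2 (Y ^ d) := by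
    intro p hp
    rw [Finset.HasAntidiagonal.mem_antidiagonal] at hp
    rw [PowerSeries.coeff_subst_eq_sum_range hY _ (show p.2 < n + 1 by omega)]
    simp
  rw [Finset.sum_congr (s₁ := Finset.HasAntidiagonal.antidiagonal n) rfl
    fun p hp => by rw [hR p hp]]
  simp only [Finset.mul_sum]
  rw [Finset.sum_comm]
  refine Finset.sum_congr rfl fun d _ => ?_
  rw [pow_succ', PowerSeries.coeff_mul, Finset.Nat.sum_antidiagonal_succ, hY, zero_mul, zero_add,
    PowerSeries.coeff_mk, Finset.mul_sum, show d + 1 + c = d + (c + 1) by omega]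
  exact Finset.sum_congr rfl fun p _ => by ring

/-- The total weight of the closed contour walks of length `k`. -/
theorem contourSum_closed (mom ρ : ℕ → ℝ) {Y : PowerSeries ℝ} (hY : PowerSeries.coeff 0 Y = 0)
    (hrec : ∀ j, PowerSeries.coeff (j + 1) Y = ρ (2 * j + 1) *
      PowerSeries.coeff j (PowerSeries.subst Y (PowerSeries.mk fun d => mom (d + 1)))) (k : ℕ) :
    contourSum mom ρ k 0 1 [] = if Even k then PowerSeries.coeff (k / 2)
      (PowerSeries.subst Y (PowerSeries.mk fun d => mom (d + 1))) else 0 := by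
  -- `M c j` is the weight of the excursions of 2j steps from a node with c visits; d further
  -- children bring its visits to d + c.
  set M : ℕ → ℕ → ℝ := fun c j =>
    PowerSeries.coeff j (PowerSeries.subst Y (PowerSeries.mk fun d => mom (d + c))) with hM
  have key := contourSum_eq_sum_antidiagonal mom ρ
    (fun A c => if Even A then M c (A / 2) else 0) ?_ ?_ ?_ k 0 1 []
  -- At the root there is no parent to return to, so only the excursion of full length survives.
  · rw [key, Finset.sum_eq_single (k, 0)]
    · simp [contourReturn, hM]
    · rintro ⟨a, b⟩ h hne
      match b with
      | 0 =>
        simp only [Finset.HasAntidiagonal.mem_antidiagonal, add_zero] at h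
        exact absurd (by rw [h]) hne
      | b + 1 => simp [contourReturn]
    · simp
  · intro c
    simp only [Even.zero, if_true, Nat.zero_div, hM]
    rw [PowerSeries.coeff_subst_eq_sum_range hY _ Nat.zero_lt_one]
    simp
  · simp
  · intro A c
    rcases Nat.even_or_odd' A with ⟨n, rfl | rfl⟩
    · rw [sum_antidiagonal_two_mul (fun a x => (if Even a then M 1 (a / 2) else 0) * ρ (a + 1) *
        (if Even x then M (c + 1) (x / 2) else 0)) n (fun a b h => by simp [h])]
      have he : Even (2 * n + 2) := ⟨n + 1, by ring⟩
      rw [if_pos he, show (2 * n + 2) / 2 = n + 1 by omega]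
      simp only [hM, coeff_succ_subst_shift mom hY c n]
      refine Finset.sum_congr rfl fun p _ => ?_
      simp only [even_two_mul, if_true, hrec, Nat.mul_div_cancel_left _ Nat.two_pos]
      ring
    · have ho : ¬ Even (2 * n + 1 + 2) := by simp [parity_simps]
      rw [if_neg ho]
      symm
      refine Finset.sum_eq_zero fun p hp => ?_
      rw [Finset.HasAntidiagonal.mem_antidiagonal] at hp
      by_cases h1 : Even p.1
      · have h2 : ¬ Even p.2 := by
          intro h2
          have := h1.add h2
          rw [hp] at this
          simp [parity_simps] at this
        simp [h2]
      · simp [h1]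

/-- The gap 2j + 1 belongs to a subtree with j + 1 nodes, and `wignerWeight β r (j + 1)` is exactly
β² r(2j + 1). -/
theorem contourSum_eq_limitMoment (β : ℝ) (r : ℕ → ℝ) (μ : Measure ℝ) (k : ℕ) :
    contourSum (fun c => ∫ x, x ^ c ∂μ) (fun d => β ^ 2 * r d) k 0 1 [] =
      if Even k then limitMoment β r μ (k / 2) else 0 := by
  rw [contourSum_closed _ _ (PlaneTree.coeff_zero_genSeries (wignerWeight β r) (momentWeight μ)),
    limitMoment_eq_coeff_subst]
  · rfl
  · intro j
    rw [PlaneTree.coeff_succ_genSeries]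
    change wignerWeight β r (j + 1) * limitMoment β r μ j = _
    rw [limitMoment_eq_coeff_subst]
    rfl

/-! ### Walks on the complete graph

A walk is the list of its vertices, starting with the last one. Its steps are numbered from `0`. -/

section Walk

variable {V : Type*} [DecidableEq V]

/-- The times at which a walk traverses an edge. -/
def walkTimes : List V → Sym2 V → Finset ℕ
  | [], _ => ∅
  | [_], _ => ∅
  | x :: y :: p, e =>
    if e = s(x, y) then insert p.length (walkTimes (y :: p) e) else walkTimes (y :: p) e

theorem walkTimes_cons {p : List V} {v : V} (hv : p.head? = some v) (x : V) (e : Sym2 V) :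
    walkTimes (x :: p) e =
      if e = s(x, v) then insert (p.length - 1) (walkTimes p e) else walkTimes p e := by
  match p with
  | [] => simp at hv
  | y :: p =>
    simp only [List.head?_cons, Option.some.injEq] at hv
    subst hv
    simp [walkTimes]

theorem lt_of_mem_walkTimes {p : List V} {e : Sym2 V} {i : ℕ} (h : i ∈ walkTimes p e) :
    i < p.length - 1 := by
  induction p with
  | nil => simp [walkTimes] at h
  | cons x p ih =>
    match p with
    | [] => simp [walkTimes] at h
    | y :: p =>
      simp only [walkTimes, List.length_cons, Nat.add_sub_cancel] at h ih ⊢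
      split_ifs at h
      · rcases Finset.mem_insert.1 h with rfl | h
        · omega
        · have := ih h
          omega
      · have := ih h
        omega

theorem mem_of_mem_walkTimes {p : List V} {e : Sym2 V} {i : ℕ} (h : i ∈ walkTimes p e) {u : V}
    (hu : u ∈ e) : u ∈ p := by
  induction p with
  | nil => simp [walkTimes] at h
  | cons x p ih =>
    match p with
    | [] => simp [walkTimes] at h
    | y :: p =>
      simp only [walkTimes] at h
      split_ifs at h with he
      · rw [he, Sym2.mem_iff] at hu
        rcases hu with rfl | rfl <;> simp
      · exact List.mem_cons_of_mem _ (ih h)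

theorem walkTimes_eq_empty {p : List V} {e : Sym2 V} {u : V} (hu : u ∈ e) (hp : u ∉ p) :
    walkTimes p e = ∅ :=
  Finset.eq_empty_of_forall_notMem fun _ hi => hp (mem_of_mem_walkTimes hi hu)

variable [Fintype V]

/-- The edges which a walk traverses exactly once. -/
def singleEdges (p : List V) : Finset (Sym2 V) := {e | (walkTimes p e).card = 1}

theorem mem_singleEdges {p : List V} {e : Sym2 V} :
    e ∈ singleEdges p ↔ (walkTimes p e).card = 1 := by
  simp [singleEdges]

theorem card_singleEdges_cons_of_notMem {p : List V} {v x : V} (hv : p.head? = some v)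
    (hx : x ∉ p) : (singleEdges p).card + 1 ≤ (singleEdges (x :: p)).card := by
  have he : walkTimes p s(x, v) = ∅ := walkTimes_eq_empty (Sym2.mem_mk_left x v) hx
  have hn : s(x, v) ∉ singleEdges p := by simp [mem_singleEdges, he]
  rw [← Finset.card_insert_of_notMem hn]
  refine Finset.card_le_card fun e h => ?_
  rw [mem_singleEdges, walkTimes_cons hv]
  rcases Finset.mem_insert.1 h with rfl | h
  · simp [he]
  · rw [if_neg (by rintro rfl; exact hn h)]
    exact mem_singleEdges.1 h

/-- A step changes the traversal times of one edge only. -/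
theorem card_singleEdges_le_cons {p : List V} {v : V} (hv : p.head? = some v) (x : V) :
    (singleEdges p).card ≤ (singleEdges (x :: p)).card + 1 := by
  refine le_trans (Finset.card_le_card (t := insert s(x, v) (singleEdges (x :: p))) fun e h => ?_)
    (Finset.card_insert_le _ _)
  by_cases he : e = s(x, v)
  · simp [he]
  · rw [Finset.mem_insert, mem_singleEdges, walkTimes_cons hv, if_neg he]
    exact Or.inr (mem_singleEdges.1 h)

theorem card_singleEdges_le_cons_of_notMem {p : List V} {v x : V} (hv : p.head? = some v)
    (hx : s(x, v) ∉ singleEdges p) : (singleEdges p).card ≤ (singleEdges (x :: p)).card := by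
  refine Finset.card_le_card fun e h => ?_
  rw [mem_singleEdges, walkTimes_cons hv, if_neg (by rintro rfl; exact hx h)]
  exact mem_singleEdges.1 h

/-- The sum of `f` over the continuations of a walk by `m` steps which end at `root`. -/
def walkSum (f : List V → ℝ) (root : V) : ℕ → List V → ℝ
  | 0, p => if p.head? = some root then f p else 0
  | m + 1, p => ∑ x, walkSum f root m (x :: p)

/-- The product of the vertex weights and the edge weights of a walk. -/
def walkValue (mom : ℕ → ℝ) (κ : Sym2 V → Finset ℕ → ℝ) (p : List V) : ℝ :=
  (∏ v, mom (p.count v)) * ∏ e, κ e (walkTimes p e)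

/-- Edge weights which depend on the set of the times at which an edge is traversed: an edge which
is traversed once has weight `0`, and one which is traversed at times `i < j` has weight
`ρ (j - i)`. -/
structure IsEdgeWeight (ρ : ℕ → ℝ) (κ : Sym2 V → Finset ℕ → ℝ) : Prop where
  empty : ∀ e, κ e ∅ = 1
  single : ∀ e i, κ e {i} = 0
  pair : ∀ e i j, ¬ e.IsDiag → i < j → κ e {i, j} = ρ (j - i)

theorem walkValue_eq_zero {mom ρ : ℕ → ℝ} {κ : Sym2 V → Finset ℕ → ℝ} (hκ : IsEdgeWeight ρ κ)
    {p : List V} (hp : (singleEdges p).Nonempty) : walkValue mom κ p = 0 := by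
  obtain ⟨e, he⟩ := hp
  obtain ⟨i, hi⟩ := Finset.card_eq_one.1 (mem_singleEdges.1 he)
  rw [walkValue, Finset.prod_eq_zero (Finset.mem_univ e) (by rw [hi, hκ.single]), mul_zero]

/-- Each edge traversed once must be traversed again, which restricts a later step to old vertices;
this is paid for by a factor 1/h per such edge. Per step the constant grows by k + 2: at most k + 1
old vertices, and 1 for all new vertices together. -/
theorem abs_walkSum_mul_le {mom ρ : ℕ → ℝ} {κ : Sym2 V → Finset ℕ → ℝ} (hκ : IsEdgeWeight ρ κ)
    {k : ℕ} {C h : ℝ} (hC : ∀ p : List V, p.length ≤ k + 1 → |walkValue mom κ p| ≤ C)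
    (hh : 1 ≤ h) (hcard : h ^ 2 = Fintype.card V) (root : V) (m : ℕ) :
    ∀ p : List V, p ≠ [] → p.length + m ≤ k + 1 →
      |walkSum (walkValue mom κ) root m p| * h ^ (singleEdges p).card ≤
        C * (k + 2) ^ m * h ^ m := by
  have hC0 : 0 ≤ C := (abs_nonneg _).trans (hC [] (by simp))
  have h0 : 0 < h := by linarith
  induction m with
  | zero =>
    intro p hp hlen
    simp only [walkSum, pow_zero, mul_one]
    rcases (singleEdges p).eq_empty_or_nonempty with he | he
    · rw [he, Finset.card_empty, pow_zero, mul_one]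
      split_ifs
      · exact hC p hlen
      · simpa using hC0
    · rw [walkValue_eq_zero hκ he]
      simpa using hC0
  | succ m ih =>
    intro p hp hlen
    obtain ⟨v, hv⟩ : ∃ v, p.head? = some v := by
      cases p with
      | nil => exact absurd rfl hp
      | cons v p => exact ⟨v, rfl⟩
    set s := (singleEdges p).card
    set B : ℝ := C * (k + 2) ^ m with hB
    have hB0 : 0 ≤ B := by positivity
    have hnew : ∀ x ∉ p, |walkSum (walkValue mom κ) root m (x :: p)| * h ^ (s + 1) ≤
        B * h ^ m := fun x hx =>
      le_trans (mul_le_mul_of_nonneg_left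
        (pow_le_pow_right₀ hh (card_singleEdges_cons_of_notMem hv hx)) (abs_nonneg _))
        (ih (x :: p) (by simp) (by simp only [List.length_cons]; omega))
    have hold : ∀ x, |walkSum (walkValue mom κ) root m (x :: p)| * h ^ s ≤ B * h ^ (m + 1) := by
      intro x
      calc |walkSum (walkValue mom κ) root m (x :: p)| * h ^ s
          ≤ |walkSum (walkValue mom κ) root m (x :: p)| *
            h ^ ((singleEdges (x :: p)).card + 1) := mul_le_mul_of_nonneg_left
              (pow_le_pow_right₀ hh (card_singleEdges_le_cons hv x)) (abs_nonneg _)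
        _ = |walkSum (walkValue mom κ) root m (x :: p)| *
            h ^ (singleEdges (x :: p)).card * h := by ring
        _ ≤ B * h ^ m * h := mul_le_mul_of_nonneg_right
            (ih (x :: p) (by simp) (by simp only [List.length_cons]; omega)) h0.le
        _ = B * h ^ (m + 1) := by ring
    have hsplit : walkSum (walkValue mom κ) root (m + 1) p =
        ∑ x ∈ p.toFinset, walkSum (walkValue mom κ) root m (x :: p) +
          ∑ x ∈ p.toFinsetᶜ, walkSum (walkValue mom κ) root m (x :: p) := by
      rw [Finset.sum_add_sum_compl]
      rfl
    have h1 : |∑ x ∈ p.toFinset, walkSum (walkValue mom κ) root m (x :: p)| * h ^ s ≤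
        (k + 1) * (B * h ^ (m + 1)) := by
      calc _ ≤ (∑ x ∈ p.toFinset, |walkSum (walkValue mom κ) root m (x :: p)|) * h ^ s := by
            gcongr
            exact Finset.abs_sum_le_sum_abs _ _
        _ = ∑ x ∈ p.toFinset, |walkSum (walkValue mom κ) root m (x :: p)| * h ^ s :=
            Finset.sum_mul _ _ _
        _ ≤ p.toFinset.card • (B * h ^ (m + 1)) :=
            Finset.sum_le_card_nsmul _ _ _ fun x _ => hold x
        _ ≤ (k + 1) * (B * h ^ (m + 1)) := by
            rw [nsmul_eq_mul]
            gcongr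
            have := p.toFinset_card_le
            exact_mod_cast (by omega : p.toFinset.card ≤ k + 1)
    have h2 : |∑ x ∈ p.toFinsetᶜ, walkSum (walkValue mom κ) root m (x :: p)| * h ^ s ≤
        B * h ^ (m + 1) := by
      -- The extra h absorbs the new single edge in `hnew`, and the h² choices of a new vertex
      -- restore the order.
      refine le_of_mul_le_mul_right ?_ h0
      calc _ ≤ (∑ x ∈ p.toFinsetᶜ, |walkSum (walkValue mom κ) root m (x :: p)|) * h ^ s * h := by
            gcongr
            exact Finset.abs_sum_le_sum_abs _ _
        _ = ∑ x ∈ p.toFinsetᶜ, |walkSum (walkValue mom κ) root m (x :: p)| * h ^ (s + 1) := by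
            rw [mul_assoc, ← pow_succ, Finset.sum_mul]
        _ ≤ p.toFinsetᶜ.card • (B * h ^ m) :=
            Finset.sum_le_card_nsmul _ _ _ fun x hx => hnew x (by simpa using hx)
        _ ≤ h ^ 2 * (B * h ^ m) := by
            rw [nsmul_eq_mul, hcard]
            gcongr
            exact Finset.card_le_univ _
        _ = B * h ^ (m + 1) * h := by ring
    calc |walkSum (walkValue mom κ) root (m + 1) p| * h ^ s
        ≤ (|∑ x ∈ p.toFinset, walkSum (walkValue mom κ) root m (x :: p)| +
          |∑ x ∈ p.toFinsetᶜ, walkSum (walkValue mom κ) root m (x :: p)|) * h ^ s := by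
          rw [hsplit]
          gcongr
          exact abs_add_le _ _
      _ ≤ (k + 1) * (B * h ^ (m + 1)) + B * h ^ (m + 1) := by
          rw [add_mul]
          exact add_le_add h1 h2
      _ = C * (k + 2) ^ (m + 1) * h ^ (m + 1) := by
          rw [hB]
          ring

/-! ### Walks around a plane tree -/

/-- The edges between consecutive vertices of the path from the current vertex to the root. The
list contains the vertices of the path other than the current vertex. -/
def stackEdges : V → List (V × ℕ × ℕ) → List (Sym2 V)
  | _, [] => []
  | v, (w, _) :: S => s(v, w) :: stackEdges w S

/-- The stack records, for each edge of the path, the only time at which it has been traversed,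
and for its end which is closer to the root the number of visits. -/
def StackRecords (p : List V) (root : V) : V → List (V × ℕ × ℕ) → Prop
  | v, [] => v = root
  | v, (w, o, c) :: S => walkTimes p s(v, w) = {o} ∧ p.count w = c ∧ StackRecords p root w S

omit [DecidableEq V] [Fintype V] in
theorem mem_of_mem_stackEdges {v : V} {S : List (V × ℕ × ℕ)} {e : Sym2 V}
    (he : e ∈ stackEdges v S) {u : V} (hu : u ∈ e) : u ∈ v :: S.map Prod.fst := by
  induction S generalizing v with
  | nil => simp [stackEdges] at he
  | cons a S ih =>
    obtain ⟨w, a⟩ := a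
    simp only [stackEdges, List.mem_cons] at he
    rcases he with rfl | he
    · rw [Sym2.mem_iff] at hu
      rcases hu with rfl | rfl <;> simp
    · exact List.mem_cons_of_mem _ (ih he)

omit [DecidableEq V] [Fintype V] in
theorem nodup_stackEdges {v : V} {S : List (V × ℕ × ℕ)} (h : (v :: S.map Prod.fst).Nodup) :
    (stackEdges v S).Nodup := by
  induction S generalizing v with
  | nil => simp [stackEdges]
  | cons a S ih =>
    obtain ⟨w, a⟩ := a
    rw [List.map_cons, List.nodup_cons] at h
    exact List.nodup_cons.2
      ⟨fun he => h.1 (mem_of_mem_stackEdges he (Sym2.mem_mk_left v w)), ih h.2⟩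

omit [DecidableEq V] [Fintype V] in
theorem length_stackEdges (v : V) (S : List (V × ℕ × ℕ)) :
    (stackEdges v S).length = S.length := by
  induction S generalizing v with
  | nil => rfl
  | cons a S ih => simp [stackEdges, ih]

omit [Fintype V] in
theorem StackRecords.card_eq_one {p : List V} {root v : V} {S : List (V × ℕ × ℕ)}
    (h : StackRecords p root v S) {e : Sym2 V} (he : e ∈ stackEdges v S) :
    (walkTimes p e).card = 1 := by
  induction S generalizing v with
  | nil => simp [stackEdges] at he
  | cons a S ih =>
    obtain ⟨w, o, c⟩ := a
    simp only [stackEdges, List.mem_cons] at he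
    rcases he with rfl | he
    · simp [h.1]
    · exact ih h.2.2 he

omit [Fintype V] in
-- Used when a step changes only a visit count and an edge that the records do not involve.
theorem StackRecords.congr {p q : List V} {root v : V} {S : List (V × ℕ × ℕ)}
    (h : StackRecords p root v S) (hc : ∀ u ∈ S.map Prod.fst, q.count u = p.count u)
    (ht : ∀ e ∈ stackEdges v S, walkTimes q e = walkTimes p e) : StackRecords q root v S := by
  induction S generalizing v with
  | nil => exact h
  | cons a S ih =>
    obtain ⟨w, o, c⟩ := a
    refine ⟨?_, ?_, ih h.2.2 (fun u hu => hc u ?_) fun e he => ht e ?_⟩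
    · rw [ht _ (by simp [stackEdges]), h.1]
    · rw [hc _ (by simp), h.2.1]
    · simp only [List.map_cons, List.mem_cons]
      exact Or.inr hu
    · simp only [stackEdges, List.mem_cons]
      exact Or.inr he

/-- The walk `p` has gone around a part of a plane tree. It is at the vertex `v` at its `c`-th
visit, the path to the root is recorded in `S`, and the vertices and edges which are not on this
path contribute the factor `val`. -/
structure IsContourState (mom : ℕ → ℝ) (κ : Sym2 V → Finset ℕ → ℝ) (root : V) (p : List V)
    (v : V) (c : ℕ) (S : List (V × ℕ × ℕ)) (val : ℝ) : Prop where
  head : p.head? = some v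
  count : p.count v = c
  nodup : (v :: S.map Prod.fst).Nodup
  subset : ∀ u ∈ v :: S.map Prod.fst, u ∈ p
  stack : StackRecords p root v S
  single : ∀ e, (walkTimes p e).card = 1 → e ∈ stackEdges v S
  value : (∏ u with u ∉ v :: S.map Prod.fst, mom (p.count u)) *
    ∏ e with e ∉ stackEdges v S, κ e (walkTimes p e) = val

omit [Fintype V] in
-- Lets a vertex or an edge pass between the path to the root and the factor off the path.
theorem prod_filter_notMem_cons {α : Type*} [DecidableEq α] [Fintype α] {a : α} {l : List α}
    (ha : a ∉ l) (f : α → ℝ) :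
    ∏ x with x ∉ l, f x = f a * ∏ x with x ∉ a :: l, f x := by
  rw [← Finset.prod_insert (by simp)]
  refine Finset.prod_congr ?_ fun _ _ => rfl
  ext x
  by_cases hx : x = a
  · simp [hx, ha]
  · simp [hx]

namespace IsContourState

variable {mom ρ : ℕ → ℝ} {κ : Sym2 V → Finset ℕ → ℝ} {root : V} {p : List V} {v : V} {c : ℕ}
  {S : List (V × ℕ × ℕ)} {val : ℝ}

theorem length_le_card (h : IsContourState mom κ root p v c S val) :
    S.length ≤ (singleEdges p).card := by
  rw [← length_stackEdges v S, ← List.toFinset_card_of_nodup (nodup_stackEdges h.nodup)]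
  refine Finset.card_le_card fun e he => ?_
  exact mem_singleEdges.2 (h.stack.card_eq_one (List.mem_toFinset.1 he))

theorem initial (hm : mom 0 = 1) (hκ : IsEdgeWeight ρ κ) (root : V) :
    IsContourState mom κ root [root] root 1 [] 1 where
  head := rfl
  count := by simp
  nodup := by simp
  subset := by simp
  stack := rfl
  single := by simp [walkTimes]
  value := by
    rw [Finset.prod_eq_one, Finset.prod_eq_one, mul_one]
    · intro e _
      simp [walkTimes, hκ.empty]
    · intro u hu
      have : u ≠ root := by simpa using hu
      rw [List.count_eq_zero_of_not_mem (by simpa using this), hm]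

/-- Before the step the new vertex and the new edge contributed `mom 0 = 1` and `κ e ∅ = 1` off the
path, so `val` does not change when they join it. -/
theorem push (hm : mom 0 = 1) (hκ : IsEdgeWeight ρ κ)
    (h : IsContourState mom κ root p v c S val) {x : V} (hx : x ∉ p) :
    IsContourState mom κ root (x :: p) x 1 ((v, p.length - 1, c) :: S) val := by
  have hxS : x ∉ v :: S.map Prod.fst := fun hx' => hx (h.subset x hx')
  have hnew : walkTimes p s(x, v) = ∅ := walkTimes_eq_empty (Sym2.mem_mk_left x v) hx
  have hcount : ∀ u, u ≠ x → (x :: p).count u = p.count u := fun u hu =>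
    List.count_cons_of_ne (Ne.symm hu)
  have hnS : s(x, v) ∉ stackEdges v S := fun he =>
    hxS (mem_of_mem_stackEdges he (Sym2.mem_mk_left x v))
  have htimes : ∀ e, e ≠ s(x, v) → walkTimes (x :: p) e = walkTimes p e := fun e he => by
    rw [walkTimes_cons h.head, if_neg he]
  refine ⟨rfl, ?_, ?_, ?_, ⟨?_, ?_, ?_⟩, ?_, ?_⟩
  · rw [List.count_cons_self, List.count_eq_zero_of_not_mem hx]
  · exact List.nodup_cons.2 ⟨hxS, h.nodup⟩
  · intro u hu
    rcases List.mem_cons.1 hu with rfl | hu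
    · simp
    · exact List.mem_cons_of_mem _ (h.subset u hu)
  · rw [walkTimes_cons h.head, if_pos rfl, hnew]
    rfl
  · rw [hcount v (by rintro rfl; exact hxS (by simp)), h.count]
  · refine h.stack.congr (fun u hu => hcount u ?_) fun e he => htimes e ?_
    · rintro rfl
      exact hxS (List.mem_cons_of_mem _ hu)
    · rintro rfl
      exact hnS he
  · intro e he
    by_cases hxe : e = s(x, v)
    · simp [stackEdges, hxe]
    · rw [htimes e hxe] at he
      exact List.mem_cons_of_mem _ (h.single e he)
  · rw [← h.value, prod_filter_notMem_cons hxS fun u => mom (p.count u),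
      prod_filter_notMem_cons hnS fun e => κ e (walkTimes p e), hnew, hκ.empty,
      List.count_eq_zero_of_not_mem hx, hm, one_mul, one_mul]
    congr 1
    · refine Finset.prod_congr rfl fun u hu => ?_
      rw [hcount u]
      rintro rfl
      simp at hu
    · refine Finset.prod_congr rfl fun e he => ?_
      rw [htimes e]
      rintro rfl
      simp at he

/-- Returning to the parent finishes v and the edge above it: v has its final c visits, and the edge
has its two times, the second being the number `p.length - 1` of the present step. Both factors move
into `val`. -/
theorem pop (hκ : IsEdgeWeight ρ κ) {w : V} {o c' : ℕ}
    (h : IsContourState mom κ root p v c ((w, o, c') :: S) val) :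
    IsContourState mom κ root (w :: p) w (c' + 1) S (mom c * ρ (p.length - 1 - o) * val) := by
  obtain ⟨ht, hc', hrec⟩ := h.stack
  have hnd := List.nodup_cons.1 h.nodup
  rw [List.map_cons] at hnd
  have hvw : w ≠ v := by
    rintro rfl
    exact hnd.1 (by simp)
  have hcount : ∀ u, u ≠ w → (w :: p).count u = p.count u := fun u hu =>
    List.count_cons_of_ne (Ne.symm hu)
  have htimes : ∀ e, e ≠ s(v, w) → walkTimes (w :: p) e = walkTimes p e := fun e he => by
    rw [walkTimes_cons h.head, if_neg (by rwa [Sym2.eq_swap])]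
  have hedge : walkTimes (w :: p) s(v, w) = {o, p.length - 1} := by
    rw [walkTimes_cons h.head, if_pos Sym2.eq_swap, ht, Finset.pair_comm]
  have ho : o < p.length - 1 := lt_of_mem_walkTimes (e := s(v, w)) (by simp [ht])
  have hnS : s(v, w) ∉ stackEdges w S := fun he =>
    hnd.1 (mem_of_mem_stackEdges he (Sym2.mem_mk_left v w))
  refine ⟨rfl, ?_, hnd.2, ?_, ?_, ?_, ?_⟩
  · rw [List.count_cons_self, hc']
  · intro u hu
    exact List.mem_cons_of_mem _ (h.subset u (List.mem_cons_of_mem _ hu))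
  · refine hrec.congr (fun u hu => hcount u ?_) fun e he => htimes e ?_
    · rintro rfl
      exact (List.nodup_cons.1 hnd.2).1 hu
    · rintro rfl
      exact hnS he
  · intro e he
    by_cases hve : e = s(v, w)
    · rw [hve, hedge, Finset.card_pair ho.ne] at he
      omega
    · rw [htimes e hve] at he
      exact (List.mem_cons.1 (h.single e he)).resolve_left hve
  · rw [prod_filter_notMem_cons hnd.1, prod_filter_notMem_cons hnS, hedge,
      hκ.pair _ _ _ (by simpa using hvw.symm) ho, hcount v hvw.symm, h.count, ← h.value]
    have h1 : ∏ u with u ∉ v :: w :: S.map Prod.fst, mom ((w :: p).count u) =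
        ∏ u with u ∉ v :: w :: S.map Prod.fst, mom (p.count u) := by
      refine Finset.prod_congr rfl fun u hu => ?_
      rw [hcount u]
      rintro rfl
      simp at hu
    have h2 : ∏ e with e ∉ s(v, w) :: stackEdges w S, κ e (walkTimes (w :: p) e) =
        ∏ e with e ∉ s(v, w) :: stackEdges w S, κ e (walkTimes p e) := by
      refine Finset.prod_congr rfl fun e he => ?_
      rw [htimes e]
      rintro rfl
      simp at he
    rw [h1, h2, mul_mul_mul_comm]
    rfl

/-- The only edge at the current vertex which the walk has traversed once leads to the parent. -/
theorem eq_parent (h : IsContourState mom κ root p v c S val) {x : V}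
    (hx : s(x, v) ∈ singleEdges p) : ∃ o c' S', S = (x, o, c') :: S' := by
  have he := h.single _ (mem_singleEdges.1 hx)
  match S with
  | [] => simp [stackEdges] at he
  | (w, o, c') :: S =>
    have hnd := (List.nodup_cons.1 h.nodup).1
    rcases List.mem_cons.1 he with he | he
    · rw [Sym2.eq_swap, Sym2.congr_right] at he
      exact ⟨o, c', S, by rw [he]⟩
    · exact absurd (mem_of_mem_stackEdges he (Sym2.mem_mk_right x v)) hnd

/-- A non-empty stack contains an edge traversed once, which annihilates the walk. If the stack is
empty, only the factor `mom c` of the root is missing from `val`. -/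
theorem walkSum_zero (hκ : IsEdgeWeight ρ κ) (h : IsContourState mom κ root p v c S val) (t : ℕ) :
    walkSum (walkValue mom κ) root 0 p =
      val * contourSum mom ρ 0 t c (S.map Prod.snd) := by
  match S with
  | [] =>
    have hroot : v = root := h.stack
    have hval := h.value
    simp only [stackEdges, List.not_mem_nil, not_false_eq_true, Finset.filter_true] at hval
    rw [walkSum, if_pos (by rw [h.head, hroot]), walkValue, List.map_nil, contourSum, ← hval]
    have := prod_filter_notMem_cons (List.not_mem_nil (a := v)) fun u => mom (p.count u)
    simp only [List.not_mem_nil, not_false_eq_true, Finset.filter_true] at this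
    rw [this, h.count, List.map_nil]
    ring
  | (w, o, c') :: S =>
    have hne : (singleEdges p).Nonempty :=
      ⟨s(v, w), mem_singleEdges.2 (by simp [h.stack.1])⟩
    rw [walkSum, walkValue_eq_zero hκ hne]
    simp [contourSum]

end IsContourState

end Walk

/-! ### The asymptotics of the sums over walks -/

theorem abs_sum_mul_sub_le {ι : Type*} (s : Finset ι) (f : ι → ℝ) {a b D : ℝ}
    (h : ∀ x ∈ s, |f x * a - b| ≤ D) : |(∑ x ∈ s, f x) * a - s.card * b| ≤ s.card * D := by
  calc |(∑ x ∈ s, f x) * a - s.card * b| = |∑ x ∈ s, (f x * a - b)| := by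
        rw [Finset.sum_sub_distrib, Finset.sum_mul, Finset.sum_const, nsmul_eq_mul]
    _ ≤ ∑ x ∈ s, |f x * a - b| := Finset.abs_sum_le_sum_abs _ _
    _ ≤ s.card • D := Finset.sum_le_card_nsmul _ _ _ h
    _ = s.card * D := nsmul_eq_mul _ _

theorem abs_mul_of_pos_right (a : ℝ) {h : ℝ} (h0 : 0 < h) : |a| * h = |a * h| := by
  rw [abs_mul, abs_of_pos h0]

/-- Boundedly many old vertices give a total one power of h below the main order h^(m+2). -/
theorem abs_sum_old_le {ι : Type*} {f : ι → ℝ} {t : Finset ι} {h B : ℝ} {m s k : ℕ} (hh : 1 ≤ h)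
    (ht : t.card ≤ k) (hB : 0 ≤ B) (hf : ∀ x ∈ t, |f x| * h ^ s ≤ B * h ^ m) :
    |(∑ x ∈ t, f x) * h ^ (s + 1)| ≤ k * B * h ^ (m + 1) := by
  have h0 : 0 < h := by linarith
  have := abs_sum_mul_sub_le t f (a := h ^ (s + 1)) (b := 0) (D := B * h ^ (m + 1)) fun x hx => by
    rw [sub_zero, ← abs_mul_of_pos_right _ (by positivity : 0 < h ^ (s + 1)), pow_succ,
      ← mul_assoc, pow_succ h m, ← mul_assoc]
    exact mul_le_mul_of_nonneg_right (hf x hx) h0.le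
  rw [mul_zero, sub_zero] at this
  refine this.trans ?_
  rw [mul_assoc]
  have : (t.card : ℝ) ≤ k := by exact_mod_cast ht
  gcongr

section Walk

variable {V : Type*} [DecidableEq V] [Fintype V]

/-- Continuations to new vertices. -/
theorem abs_sum_new_sub_le {f : V → ℝ} {p : List V} {h a D : ℝ} {m s k : ℕ} (hh : 1 ≤ h)
    (hcard : h ^ 2 = Fintype.card V) (hp : p.length ≤ k) (hD : 0 ≤ D)
    (hf : ∀ x ∉ p, |f x * h ^ (s + 2) - a * h ^ (m + 1)| ≤ D * h ^ m) :
    |(∑ x ∈ p.toFinsetᶜ, f x) * h ^ (s + 1) - a * h ^ (m + 2)| ≤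
      (D + k * |a|) * h ^ (m + 1) := by
  have h0 : 0 < h := by linarith
  have hsum := abs_sum_mul_sub_le p.toFinsetᶜ f (a := h ^ (s + 2)) (b := a * h ^ (m + 1))
    (D := D * h ^ m) fun x hx => hf x (by simpa using hx)
  -- Replacing the number of new vertices by h² accounts for the summand `k * |a|` of the constant.
  have hc : (p.toFinsetᶜ.card : ℝ) = h ^ 2 - p.toFinset.card := by
    rw [hcard, Finset.card_compl, Nat.cast_sub (Finset.card_le_univ _)]
  have hpc : (p.toFinset.card : ℝ) ≤ k := by
    exact_mod_cast p.toFinset_card_le.trans hp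
  have hle : (p.toFinsetᶜ.card : ℝ) ≤ h ^ 2 := by
    rw [hc]
    linarith [Nat.cast_nonneg (α := ℝ) p.toFinset.card]
  refine le_of_mul_le_mul_right ?_ h0
  have e1 : |(∑ x ∈ p.toFinsetᶜ, f x) * h ^ (s + 1) - a * h ^ (m + 2)| * h =
      |((∑ x ∈ p.toFinsetᶜ, f x) * h ^ (s + 2) - p.toFinsetᶜ.card * (a * h ^ (m + 1))) -
        p.toFinset.card * (a * h ^ (m + 1))| := by
    rw [abs_mul_of_pos_right _ h0, hc]
    congr 1
    ring
  rw [e1]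
  refine (abs_sub _ _).trans ?_
  have e2 : |(p.toFinset.card : ℝ) * (a * h ^ (m + 1))| ≤ k * |a| * h ^ (m + 1) := by
    rw [abs_mul, abs_mul, abs_of_nonneg (Nat.cast_nonneg _),
      abs_of_nonneg (by positivity : 0 ≤ h ^ (m + 1)),
      mul_assoc]
    gcongr
  have e3 : (p.toFinsetᶜ.card : ℝ) * (D * h ^ m) ≤ D * h ^ (m + 1) * h := by
    calc (p.toFinsetᶜ.card : ℝ) * (D * h ^ m) ≤ h ^ 2 * (D * h ^ m) := by gcongr
      _ = D * h ^ (m + 1) * h := by ring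
  have e4 : k * |a| * h ^ (m + 1) ≤ k * |a| * h ^ (m + 1) * h :=
    le_mul_of_one_le_right (by positivity) hh
  calc _ ≤ D * h ^ (m + 1) * h + k * |a| * h ^ (m + 1) * h :=
        add_le_add (hsum.trans e3) (e2.trans e4)
    _ = _ := by ring

end Walk

/-- The sum over the continuations of a contour walk is, up to a relative error of order
`N ^ (-1/2)` which is uniform in the walk, given by the continuations to contour walks. -/
theorem abs_walkSum_sub_contourSum_le {mom ρ : ℕ → ℝ} (hm : mom 0 = 1) (k : ℕ) {C : ℝ}
    (hC0 : 0 ≤ C) (m : ℕ) : ∀ (t c : ℕ) (L : List (ℕ × ℕ)) (val : ℝ), t + m ≤ k →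
    ∃ D : ℝ, 0 ≤ D ∧ ∀ (N : ℕ) (h : ℝ) (κ : Sym2 (Fin N) → Finset ℕ → ℝ),
      1 ≤ h → h ^ 2 = N → IsEdgeWeight ρ κ →
      (∀ p : List (Fin N), p.length ≤ k + 1 → |walkValue mom κ p| ≤ C) →
      ∀ (root : Fin N) (p : List (Fin N)) (v : Fin N) (S : List (Fin N × ℕ × ℕ)),
        p.length = t + 1 → S.map Prod.snd = L → IsContourState mom κ root p v c S val →
        |walkSum (walkValue mom κ) root m p * h ^ (L.length + 1) -
          val * contourSum mom ρ m t c L * h ^ (m + 1)| ≤ D * h ^ m := by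
  induction m with
  | zero =>
    intro t c L val _
    match L with
    | [] =>
      refine ⟨0, le_rfl, ?_⟩
      intro N h κ hh hcard hκ hC root p v S hp hS hst
      rw [hst.walkSum_zero hκ t, hS]
      simp
    | a :: L =>
      refine ⟨0, le_rfl, ?_⟩
      intro N h κ hh hcard hκ hC root p v S hp hS hst
      rw [hst.walkSum_zero hκ t, hS]
      simp [contourSum]
  | succ m ih =>
    intro t c L val htm
    -- The constants are chosen from times, visit counts and `val` before N and the vertices appear,
    -- which makes them uniform.
    obtain ⟨D₁, hD₁, H₁⟩ := ih (t + 1) 1 ((t, c) :: L) val (by omega)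
    set B : ℝ := C * (k + 2) ^ m with hB
    have hB0 : 0 ≤ B := by positivity
    set F₁ := contourSum mom ρ m (t + 1) 1 ((t, c) :: L) with hF₁
    have common : ∀ (N : ℕ) (h : ℝ) (κ : Sym2 (Fin N) → Finset ℕ → ℝ),
      1 ≤ h → h ^ 2 = N → IsEdgeWeight ρ κ →
      (∀ p : List (Fin N), p.length ≤ k + 1 → |walkValue mom κ p| ≤ C) →
      ∀ (root : Fin N) (p : List (Fin N)) (v : Fin N) (S : List (Fin N × ℕ × ℕ)),
        p.length = t + 1 → S.map Prod.snd = L → IsContourState mom κ root p v c S val →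
        |(∑ x ∈ p.toFinsetᶜ, walkSum (walkValue mom κ) root m (x :: p)) * h ^ (L.length + 1) -
          val * F₁ * h ^ (m + 2)| ≤ (D₁ + (k + 1 : ℕ) * |val * F₁|) * h ^ (m + 1) ∧
        ∀ x, s(x, v) ∉ singleEdges p → |walkSum (walkValue mom κ) root m (x :: p)| *
          h ^ L.length ≤ B * h ^ m := by
      intro N h κ hh hcard hκ hC root p v S hp hS hst
      refine ⟨?_, fun x hx => ?_⟩
      · refine abs_sum_new_sub_le hh (by simpa using hcard) (by omega) hD₁ fun x hx => ?_
        refine H₁ N h κ hh hcard hκ hC root (x :: p) x ((v, t, c) :: S) (by simp [hp])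
          (by simp [hS]) ?_
        have := hst.push hm hκ hx
        rwa [hp, Nat.add_sub_cancel] at this
      -- A step that does not retrace a single edge keeps at least `L.length` of them, so the
      -- general bound falls short of the main term by a factor h.
      · have hlen : L.length ≤ (singleEdges (x :: p)).card := by
          rw [← hS, List.length_map]
          exact hst.length_le_card.trans (card_singleEdges_le_cons_of_notMem hst.head hx)
        refine le_trans (mul_le_mul_of_nonneg_left (pow_le_pow_right₀ hh hlen) (abs_nonneg _)) ?_
        exact abs_walkSum_mul_le hκ hC hh (by simpa using hcard) root m (x :: p) (by simp)
          (by simp only [List.length_cons]; omega)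
    have hsplit : ∀ (N : ℕ) (κ : Sym2 (Fin N) → Finset ℕ → ℝ) (root : Fin N) (p : List (Fin N)),
        walkSum (walkValue mom κ) root (m + 1) p =
          ∑ x ∈ p.toFinset, walkSum (walkValue mom κ) root m (x :: p) +
            ∑ x ∈ p.toFinsetᶜ, walkSum (walkValue mom κ) root m (x :: p) := by
      intro N κ root p
      rw [Finset.sum_add_sum_compl]
      rfl
    rcases L with _ | ⟨⟨o, c'⟩, L⟩
    · refine ⟨(k + 1 : ℕ) * B + (D₁ + (k + 1 : ℕ) * |val * F₁|), by positivity, ?_⟩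
      intro N h κ hh hcard hκ hC root p v S hp hS hst
      obtain ⟨hnew, hother⟩ := common N h κ hh hcard hκ hC root p v S hp hS hst
      have hold := abs_sum_old_le (f := fun x => walkSum (walkValue mom κ) root m (x :: p))
        (t := p.toFinset) (k := k + 1) hh
        (by have := p.toFinset_card_le; omega) hB0 fun x _ => hother x fun hx => by
          obtain ⟨o, c', S', rfl⟩ := hst.eq_parent hx
          simp at hS
      rw [hsplit, add_mul, add_mul, add_sub_assoc, contourSum]
      exact (abs_add_le _ _).trans (add_le_add hold hnew)
    · obtain ⟨D₂, hD₂, H₂⟩ := ih (t + 1) (c' + 1) L (mom c * ρ (t - o) * val) (by omega)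
      refine ⟨(k + 1 : ℕ) * B + (D₁ + (k + 1 : ℕ) * |val * F₁|) + D₂, by positivity, ?_⟩
      intro N h κ hh hcard hκ hC root p v S hp hS hst
      obtain ⟨hnew, hother⟩ := common N h κ hh hcard hκ hC root p v S hp hS hst
      match S, hS, hst, hother with
      | [], hS, _, _ => simp at hS
      | (w, o', c'') :: S, hS, hst, hother =>
        simp only [List.map_cons, List.cons.injEq, Prod.mk.injEq] at hS
        obtain ⟨⟨rfl, rfl⟩, hSL⟩ := hS
        have hw : w ∈ p.toFinset := List.mem_toFinset.2 (hst.subset w (by simp))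
        -- The parent w is set apart from the other old vertices: only the edge to it is single at
        -- v.
        have hold := abs_sum_old_le (f := fun x => walkSum (walkValue mom κ) root m (x :: p))
          (t := p.toFinset.erase w) (k := k + 1) hh
          (by have := p.toFinset_card_le; have := p.toFinset.card_erase_le (a := w); omega) hB0
          fun x hx => hother x fun hx' => by
            obtain ⟨_, _, _, hS'⟩ := hst.eq_parent hx'
            simp only [List.cons.injEq, Prod.mk.injEq] at hS'
            exact (Finset.mem_erase.1 hx).1 hS'.1.1.symm
        have hpop := hst.pop hκ
        rw [hp, Nat.add_sub_cancel] at hpop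
        have hback := H₂ N h κ hh hcard hκ hC root (w :: p) w S (by simp [hp]) hSL hpop
        -- The return shortens the stack by one, so one more factor h is needed to reach the common
        -- power.
        have hback' := mul_le_mul_of_nonneg_right hback (by linarith : 0 ≤ h)
        rw [abs_mul_of_pos_right _ (by linarith : 0 < h)] at hback'
        have hdecomp : walkSum (walkValue mom κ) root (m + 1) p *
              h ^ (((o', c'') :: L).length + 1) -
              val * contourSum mom ρ (m + 1) t c ((o', c'') :: L) * h ^ (m + 1 + 1) =
            (∑ x ∈ p.toFinset.erase w, walkSum (walkValue mom κ) root m (x :: p)) *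
              h ^ (((o', c'') :: L).length + 1) +
            ((∑ x ∈ p.toFinsetᶜ, walkSum (walkValue mom κ) root m (x :: p)) *
              h ^ (((o', c'') :: L).length + 1) - val * F₁ * h ^ (m + 2)) +
            (walkSum (walkValue mom κ) root m (w :: p) * h ^ (L.length + 1) -
              mom c * ρ (t - o') * val * contourSum mom ρ m (t + 1) (c'' + 1) L *
                h ^ (m + 1)) * h := by
          rw [hsplit, ← Finset.sum_erase_add _ _ hw, contourSum, hF₁, List.length_cons]
          ring
        rw [hdecomp, add_mul, add_mul]
        refine (abs_add_three _ _ _).trans (add_le_add (add_le_add hold hnew) ?_)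
        exact hback'.trans_eq (by ring)

/-- The normalized sums over closed walks converge to the sum over the contour walks. -/
theorem tendsto_walkSum {mom ρ : ℕ → ℝ} (hm : mom 0 = 1) (k : ℕ) {C : ℝ}
    (κ : ∀ N, Sym2 (Fin N) → Finset ℕ → ℝ) (hκ : ∀ N, IsEdgeWeight ρ (κ N))
    (hC : ∀ N (p : List (Fin N)), p.length ≤ k + 1 → |walkValue mom (κ N) p| ≤ C) :
    Tendsto (fun N : ℕ => (N : ℝ)⁻¹ * ((N : ℝ) ^ (-(k : ℝ) / 2) *
      ∑ v : Fin N, walkSum (walkValue mom (κ N)) v k [v])) atTop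
      (𝓝 (contourSum mom ρ k 0 1 [])) := by
  have hC0 : 0 ≤ C := (abs_nonneg _).trans (hC 0 [] (by simp))
  obtain ⟨D, hD, H⟩ := abs_walkSum_sub_contourSum_le (ρ := ρ) hm k hC0 k 0 1 [] 1 (by omega)
  set F := contourSum mom ρ k 0 1 []
  rw [tendsto_iff_norm_sub_tendsto_zero]
  have hlim : Tendsto (fun N : ℕ => D * (√(N : ℝ))⁻¹) atTop (𝓝 0) := by
    have h1 : Tendsto (fun N : ℕ => √(N : ℝ)) atTop atTop :=
      Real.tendsto_sqrt_atTop.comp tendsto_natCast_atTop_atTop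
    simpa using h1.inv_tendsto_atTop.const_mul D
  refine squeeze_zero' (Eventually.of_forall fun _ => norm_nonneg _) ?_ hlim
  filter_upwards [eventually_ge_atTop 1] with N hN
  have hN1 : (1 : ℝ) ≤ N := by exact_mod_cast hN
  set h := √(N : ℝ) with hh
  have h1 : 1 ≤ h := Real.one_le_sqrt.2 hN1
  have h0 : 0 < h := by linarith
  have h2 : h ^ 2 = N := Real.sq_sqrt (by linarith)
  have hpow : (N : ℝ) ^ (-(k : ℝ) / 2) = (h ^ k)⁻¹ := by
    rw [hh, Real.sqrt_eq_rpow, ← Real.rpow_natCast, ← Real.rpow_mul (by linarith),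
      ← Real.rpow_neg (by linarith)]
    congr 1
    ring
  have hsum := abs_sum_mul_sub_le Finset.univ
    (fun v : Fin N => walkSum (walkValue mom (κ N)) v k [v]) (a := h) (b := F * h ^ (k + 1))
    (D := D * h ^ k) fun v _ => by
      have := H N h (κ N) h1 h2 (hκ N) (hC N) v [v] v [] (by simp) (by simp)
        (IsContourState.initial hm (hκ N) v)
      simpa using this
  rw [Finset.card_univ, Fintype.card_fin, ← h2] at hsum
  rw [hpow, ← h2, Real.norm_eq_abs]
  -- Each of the h² starting points has an error of at most D h^k; after division by h^(k+3) the
  -- total is D / h.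
  have e : (h ^ 2)⁻¹ * ((h ^ k)⁻¹ * ∑ v : Fin N, walkSum (walkValue mom (κ N)) v k [v]) - F =
      ((∑ v : Fin N, walkSum (walkValue mom (κ N)) v k [v]) * h - h ^ 2 * (F * h ^ (k + 1))) /
        h ^ (k + 3) := by
    field_simp
    ring
  rw [e, abs_div, abs_of_pos (by positivity : 0 < h ^ (k + 3)), div_le_iff₀ (by positivity)]
  refine hsum.trans_eq ?_
  field_simp
  ring

/-! ### The trace of a product of matrices as a sum over walks -/

section PathWeight

variable {V : Type*} [DecidableEq V] [Fintype V]

/-- The product of the vertex weights and of the edge weights along a walk, where the weight of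
an edge may depend on the time. -/
def pathWeight (d : V → ℝ) (g : Sym2 V → ℕ → ℝ) (p : List V) : ℝ :=
  (∏ v, d v ^ p.count v) * ∏ e, ∏ i ∈ walkTimes p e, g e i

theorem pathWeight_singleton (d : V → ℝ) (g : Sym2 V → ℕ → ℝ) (v : V) :
    pathWeight d g [v] = d v := by
  rw [pathWeight, Finset.prod_eq_single v]
  · simp [walkTimes]
  · intro u _ hu
    rw [List.count_eq_zero_of_not_mem (by simpa using hu), pow_zero]
  · simp

theorem pathWeight_cons (d : V → ℝ) (g : Sym2 V → ℕ → ℝ) {p : List V} {v : V}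
    (hv : p.head? = some v) (x : V) :
    pathWeight d g (x :: p) = pathWeight d g p * (g s(x, v) (p.length - 1) * d x) := by
  have h1 : ∏ u, d u ^ (x :: p).count u = d x * ∏ u, d u ^ p.count u := by
    have : ∀ u, d u ^ (x :: p).count u = (if u = x then d x else 1) * d u ^ p.count u := by
      intro u
      by_cases hu : u = x
      · rw [if_pos hu, hu, List.count_cons_self, pow_succ']
      · rw [if_neg hu, List.count_cons_of_ne (Ne.symm hu), one_mul]
    simp only [this, Finset.prod_mul_distrib, Finset.prod_ite_eq', Finset.mem_univ, if_true]
  have h2 : ∏ e, ∏ i ∈ walkTimes (x :: p) e, g e i =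
      g s(x, v) (p.length - 1) * ∏ e, ∏ i ∈ walkTimes p e, g e i := by
    have : ∀ e, ∏ i ∈ walkTimes (x :: p) e, g e i =
        (if e = s(x, v) then g s(x, v) (p.length - 1) else 1) *
          ∏ i ∈ walkTimes p e, g e i := by
      intro e
      rw [walkTimes_cons hv]
      by_cases he : e = s(x, v)
      · rw [if_pos he, if_pos he, Finset.prod_insert, he]
        exact fun h => (lt_of_mem_walkTimes h).false
      · rw [if_neg he, if_neg he, one_mul]
    simp only [this, Finset.prod_mul_distrib, Finset.prod_ite_eq', Finset.mem_univ, if_true]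
  rw [pathWeight, pathWeight, h1, h2]
  ring

/-- A step from v to x contributes the entry (v, x) and the diagonal weight of x; the weight of the
current vertex is already in `pathWeight d g p`. By `hg` the matrices are symmetric, so edges need
no orientation. -/
theorem walkSum_pathWeight (A : ℕ → Matrix V V ℝ) (d : V → ℝ) (g : Sym2 V → ℕ → ℝ)
    (hg : ∀ i x y, g s(x, y) i = A i y x) (root : V) (m : ℕ) :
    ∀ (p : List V) (v : V) (t : ℕ), p.head? = some v → p.length = t + 1 →
      walkSum (pathWeight d g) root m p = pathWeight d g p *
        ((List.range' t m).map fun i => A i * Matrix.diagonal d).prod v root := by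
  induction m with
  | zero =>
    intro p v t hv _
    simp [walkSum, hv, Matrix.one_apply]
  | succ m ih =>
    intro p v t hv ht
    rw [walkSum, List.range'_succ, List.map_cons, List.prod_cons, Matrix.mul_apply,
      Finset.mul_sum]
    refine Finset.sum_congr rfl fun x _ => ?_
    rw [ih (x :: p) x (t + 1) rfl (by simp [ht]), pathWeight_cons d g hv, Matrix.mul_diagonal, hg,
      ht, Nat.add_sub_cancel]
    ring

theorem walkSum_integrable {Ω : Type*} [MeasurableSpace Ω] {P : Measure Ω}
    {f : Ω → List V → ℝ} (hf : ∀ p, Integrable (fun ω => f ω p) P) (root : V) (m : ℕ) :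
    ∀ p, Integrable (fun ω => walkSum (f ω) root m p) P ∧
      ∫ ω, walkSum (f ω) root m p ∂P = walkSum (fun p => ∫ ω, f ω p ∂P) root m p := by
  induction m with
  | zero =>
    intro p
    simp only [walkSum]
    split_ifs
    · exact ⟨hf p, rfl⟩
    · simp
  | succ m ih =>
    intro p
    simp only [walkSum]
    refine ⟨integrable_finsetSum _ fun x _ => (ih _).1, ?_⟩
    rw [integral_finsetSum _ fun x _ => (ih _).1]
    exact Finset.sum_congr rfl fun x _ => (ih _).2

theorem sum_card_walkTimes_le (p : List V) : ∑ e, (walkTimes p e).card ≤ p.length := by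
  induction p with
  | nil => simp [walkTimes]
  | cons x p ih =>
    match p with
    | [] => simp [walkTimes]
    | y :: p =>
      have : ∀ e, (walkTimes (x :: y :: p) e).card ≤
          (if e = s(x, y) then 1 else 0) + (walkTimes (y :: p) e).card := by
        intro e
        rw [walkTimes]
        split_ifs
        · exact (Finset.card_insert_le _ _).trans_eq (add_comm _ _)
        · simp
      refine (Finset.sum_le_sum fun e _ => this e).trans ?_
      rw [Finset.sum_add_distrib, Finset.sum_ite_eq' Finset.univ]
      simp only [Finset.mem_univ, if_true, List.length_cons] at ih ⊢
      omega

theorem abs_prod_le_pow {ι : Type*} [Fintype ι] (f : ι → ℝ) (n : ι → ℕ) {A : ℝ} {k : ℕ}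
    (hA : 1 ≤ A) (hn : ∑ i, n i ≤ k) (hf : ∀ i, |f i| ≤ A ^ n i) : |∏ i, f i| ≤ A ^ k := by
  rw [Finset.abs_prod]
  calc ∏ i, |f i| ≤ ∏ i, A ^ n i := Finset.prod_le_prod (fun _ _ => abs_nonneg _) fun i _ => hf i
    _ = A ^ ∑ i, n i := Finset.prod_pow_eq_pow_sum _ _ _
    _ ≤ A ^ k := pow_le_pow_right₀ hA hn

/-- A bound for the value of a walk in terms of bounds for its factors. -/
theorem abs_walkValue_le {mom : ℕ → ℝ} {κ : Sym2 V → Finset ℕ → ℝ} {A B : ℝ} {k : ℕ}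
    (hA : 1 ≤ A) (hB : 1 ≤ B) (h0 : mom 0 = 1) (hmom : ∀ c ≤ k + 1, |mom c| ≤ A)
    (hempty : ∀ e, κ e ∅ = 1)
    (hκ : ∀ e S, S.Nonempty → S ⊆ Finset.range k → |κ e S| ≤ B) (p : List V)
    (hp : p.length ≤ k + 1) : |walkValue mom κ p| ≤ A ^ (k + 1) * B ^ (k + 1) := by
  rw [walkValue, abs_mul]
  refine mul_le_mul (abs_prod_le_pow _ (fun v => p.count v) hA ?_ fun v => ?_)
    (abs_prod_le_pow _ (fun e => (walkTimes p e).card) hB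
      ((sum_card_walkTimes_le p).trans hp) fun e => ?_) (abs_nonneg _) (by positivity)
  · refine le_trans (le_of_eq ?_) hp
    have := Multiset.sum_count_eq_card (s := Finset.univ) (m := (p : Multiset V)) (by simp)
    simpa using this
  -- Unvisited vertices and untraversed edges give the factor 1, so the bound depends on the length
  -- of the walk but not on the number of vertices.
  · rcases Nat.eq_zero_or_pos (p.count v) with h | h
    · simp [h, h0]
    · exact (hmom _ (List.count_le_length.trans hp)).trans (le_self_pow₀ hA h.ne')
  · rcases (walkTimes p e).eq_empty_or_nonempty with h | h
    · simp [h, hempty]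
    · refine (hκ e _ h fun i hi => ?_).trans (le_self_pow₀ hB (Finset.card_pos.2 h).ne')
      have := lt_of_mem_walkTimes hi
      rw [Finset.mem_range]
      omega

end PathWeight

/-- The normalized trace of the product of matrices as a sum over closed walks. -/
theorem trace_wignerProduct {N : ℕ} (G : ℕ+ → Matrix (Fin N) (Fin N) ℝ) (d : Fin N → ℝ)
    (g : Sym2 (Fin N) → ℕ → ℝ) (hg : ∀ i x y, g s(x, y) i = G i.succPNat y x) (k : ℕ) :
    (wignerProduct G d k).trace =
      (N : ℝ) ^ (-(k : ℝ) / 2) * ∑ v, walkSum (pathWeight d g) v k [v] := by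
  rw [wignerProduct, Matrix.trace_smul, smul_eq_mul, Matrix.trace]
  congr 1
  refine Finset.sum_congr rfl fun v _ => ?_
  rw [walkSum_pathWeight (fun i => G i.succPNat) d g hg v k [v] v 0 rfl rfl, pathWeight_singleton,
    Matrix.diag_apply, Matrix.diagonal_mul, List.range_eq_range']

/-! ### Products of random variables with moments of all orders -/

/-- Every factor is at most the largest one; joint moments are thus controlled by absolute moments
of single variables. -/
theorem abs_prod_le_sum_pow {ι : Type*} {s : Finset ι} (hs : s.Nonempty) (x : ι → ℝ) :
    |∏ i ∈ s, x i| ≤ ∑ i ∈ s, |x i| ^ s.card := by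
  obtain ⟨i₀, hi₀, hmax⟩ := s.exists_max_image (fun i => |x i|) hs
  rw [Finset.abs_prod]
  calc ∏ i ∈ s, |x i| ≤ ∏ _i ∈ s, |x i₀| := Finset.prod_le_prod (fun _ _ => abs_nonneg _) hmax
    _ = |x i₀| ^ s.card := by simp
    _ ≤ ∑ i ∈ s, |x i| ^ s.card :=
      Finset.single_le_sum (f := fun i => |x i| ^ s.card) (fun _ _ => by positivity) hi₀

section Moments

variable {Ω : Type*} [MeasurableSpace Ω] {P : Measure Ω} {ι : Type*}

theorem integrable_prod_of_moments [IsFiniteMeasure P] {X : ι → Ω → ℝ} (s : Finset ι)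
    (hX : ∀ i, AEStronglyMeasurable (X i) P)
    (hint : ∀ i n, Integrable (fun ω => |X i ω| ^ n) P) :
    Integrable (fun ω => ∏ i ∈ s, X i ω) P := by
  rcases s.eq_empty_or_nonempty with rfl | hs
  · simp
  refine Integrable.mono' (integrable_finsetSum s fun i _ => hint i s.card)
    (Finset.aestronglyMeasurable_fun_prod s fun i _ => hX i) (Eventually.of_forall fun ω => ?_)
  exact abs_prod_le_sum_pow hs fun i => X i ω

theorem abs_integral_prod_le [IsFiniteMeasure P] {X : ι → Ω → ℝ} {s : Finset ι}
    (hs : s.Nonempty) (hint : ∀ i n, Integrable (fun ω => |X i ω| ^ n) P) :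
    |∫ ω, ∏ i ∈ s, X i ω ∂P| ≤ ∑ i ∈ s, ∫ ω, |X i ω| ^ s.card ∂P := by
  rw [← integral_finsetSum s fun i _ => hint i s.card]
  rw [← Real.norm_eq_abs]
  exact norm_integral_le_of_norm_le (integrable_finsetSum s fun i _ => hint i s.card)
    (Eventually.of_forall fun ω => abs_prod_le_sum_pow hs fun i => X i ω)

/-- Uniform bounds for the moments of order at least `2` give bounds for all moments. -/
theorem moments_of_moments_ge_two [IsProbabilityMeasure P] {X : Ω → ℝ} (hX : Measurable X)
    {c : ℕ → ℝ} (h : ∀ k, 2 ≤ k → Integrable (fun ω => |X ω| ^ k) P ∧ ∫ ω, |X ω| ^ k ∂P ≤ c k)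
    (n : ℕ) : Integrable (fun ω => |X ω| ^ n) P ∧ ∫ ω, |X ω| ^ n ∂P ≤ 1 + |c 2| + |c n| := by
  have hc : ∫ ω, |X ω| ^ 2 ∂P ≤ |c 2| := (h 2 le_rfl).2.trans (le_abs_self _)
  match n with
  | 0 =>
    simp only [pow_zero]
    refine ⟨integrable_const 1, ?_⟩
    simp only [integral_const, probReal_univ, smul_eq_mul, mul_one]
    linarith [abs_nonneg (c 2), abs_nonneg (c 0)]
  | 1 =>
    have hle : ∀ ω, |X ω| ≤ 1 + |X ω| ^ 2 := fun ω => by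
      nlinarith [sq_nonneg (|X ω| - 1), abs_nonneg (X ω)]
    have hint : Integrable (fun ω => 1 + |X ω| ^ 2) P := (integrable_const 1).add (h 2 le_rfl).1
    have hXint : Integrable (fun ω => |X ω|) P :=
      hint.mono' hX.abs.aestronglyMeasurable (Eventually.of_forall fun ω => by simpa using hle ω)
    simp only [pow_one]
    refine ⟨hXint, (integral_mono hXint hint hle).trans ?_⟩
    rw [integral_add (integrable_const 1) (h 2 le_rfl).1]
    simp only [integral_const, probReal_univ, smul_eq_mul, mul_one]
    linarith [abs_nonneg (c 1)]
  | n + 2 =>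
    refine ⟨(h (n + 2) (by omega)).1, (h (n + 2) (by omega)).2.trans ?_⟩
    linarith [le_abs_self (c (n + 2)), abs_nonneg (c 2)]

end Moments

/-! ### Expectations of the weights of walks -/

/-- The entries of the matrices of a process, indexed by edges and times. -/
def edgeEntry {Ω : Type*} {N : ℕ} (G : ℕ+ → Ω → Matrix (Fin N) (Fin N) ℝ) (ω : Ω)
    (e : Sym2 (Fin N)) (i : ℕ) : ℝ :=
  G i.succPNat ω e.inf e.sup

/-- The joint moments of the entries of the matrices of a process. -/
noncomputable def edgeMoment {Ω : Type*} [MeasurableSpace Ω] {N : ℕ} (P : Measure Ω)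
    (G : ℕ+ → Ω → Matrix (Fin N) (Fin N) ℝ) (e : Sym2 (Fin N)) (S : Finset ℕ) : ℝ :=
  ∫ ω, ∏ i ∈ S, edgeEntry G ω e i ∂P

section WignerProcess

variable {Ω : ℕ → Type*} [∀ N, MeasurableSpace (Ω N)] {P : ∀ N, Measure (Ω N)} {β : ℝ}
  {R : ℕ+ → ℕ+ → ℝ} {r : ℕ → ℝ} {Γ : ∀ N, ℕ+ → Ω N → Matrix (Fin N) (Fin N) ℝ}

theorem IsWignerProcess.edgeEntry_mk (hΓ : IsWignerProcess P β R Γ) (N : ℕ) (ω : Ω N)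
    (x y : Fin N) (i : ℕ) : edgeEntry (Γ N) ω s(x, y) i = Γ N i.succPNat ω y x := by
  rw [edgeEntry, Sym2.inf_mk, Sym2.sup_mk]
  rcases le_total x y with h | h
  · rw [inf_eq_left.2 h, sup_eq_right.2 h, (hΓ.wigner _).symmetric]
  · rw [inf_eq_right.2 h, sup_eq_left.2 h]

theorem IsWignerProcess.measurable_edgeEntry (hΓ : IsWignerProcess P β R Γ) (N : ℕ)
    (e : Sym2 (Fin N)) (i : ℕ) : Measurable fun ω => edgeEntry (Γ N) ω e i :=
  (hΓ.wigner _).measurable N _ _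

theorem IsWignerProcess.isEdgeWeight [∀ N, IsProbabilityMeasure (P N)]
    (hΓ : IsWignerProcess P β R Γ) (hr : IsStationaryCorrelation R r) (N : ℕ) :
    IsEdgeWeight (fun d => β ^ 2 * r d) (edgeMoment (P N) (Γ N)) where
  empty e := by simp [edgeMoment]
  single e i := by
    simp only [edgeMoment, Finset.prod_singleton]
    exact (hΓ.wigner _).centered N _ _
  pair e i j he hij := by
    induction e with | _ x y
    rw [Sym2.mk_isDiag_iff] at he
    simp only [edgeMoment, Finset.prod_pair hij.ne, hΓ.edgeEntry_mk]
    have h := hΓ.correlated N y x (Ne.symm he) j.succPNat i.succPNat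
      (Nat.succPNat_le_succPNat.2 hij.le)
    rw [hr] at h
    rw [show (fun ω => Γ N i.succPNat ω y x * Γ N j.succPNat ω y x) =
      fun ω => Γ N j.succPNat ω y x * Γ N i.succPNat ω y x from funext fun ω => mul_comm _ _, h]
    congr 2
    simp only [Nat.succPNat_coe, Nat.succ_eq_add_one]
    omega

theorem IsWignerProcess.exists_moment_bound [∀ N, IsProbabilityMeasure (P N)]
    (hΓ : IsWignerProcess P β R Γ) : ∃ c : ℕ → ℕ → ℝ, ∀ N e i n,
      Integrable (fun ω => |edgeEntry (Γ N) ω e i| ^ n) (P N) ∧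
        ∫ ω, |edgeEntry (Γ N) ω e i| ^ n ∂(P N) ≤ c i n := by
  choose c hc using fun k => (hΓ.wigner k).moments
  refine ⟨fun i n => 1 + |c i.succPNat 2| + |c i.succPNat n|, fun N e i n => ?_⟩
  exact moments_of_moments_ge_two (hΓ.measurable_edgeEntry N e i)
    (fun k hk => hc i.succPNat k hk N _ _) n

/-- The moment bounds may vary with the time, but only the finitely many subsets of the times below
k matter. -/
theorem IsWignerProcess.exists_edgeMoment_bound [∀ N, IsProbabilityMeasure (P N)]
    (hΓ : IsWignerProcess P β R Γ) (k : ℕ) : ∃ B : ℝ, 1 ≤ B ∧ ∀ N e (S : Finset ℕ),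
      S.Nonempty → S ⊆ Finset.range k → |edgeMoment (P N) (Γ N) e S| ≤ B := by
  obtain ⟨c, hc⟩ := hΓ.exists_moment_bound
  refine ⟨1 + ∑ S ∈ (Finset.range k).powerset, |∑ i ∈ S, c i S.card|,
    le_add_of_nonneg_right (Finset.sum_nonneg fun _ _ => abs_nonneg _), ?_⟩
  intro N e S hS hSk
  calc |edgeMoment (P N) (Γ N) e S|
      ≤ ∑ i ∈ S, ∫ ω, |edgeEntry (Γ N) ω e i| ^ S.card ∂(P N) :=
        abs_integral_prod_le (X := fun i ω => edgeEntry (Γ N) ω e i) hS fun i n => (hc N e i n).1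
    _ ≤ ∑ i ∈ S, c i S.card := Finset.sum_le_sum fun i _ => (hc N e i _).2
    _ ≤ |∑ i ∈ S, c i S.card| := le_abs_self _
    _ ≤ ∑ S ∈ (Finset.range k).powerset, |∑ i ∈ S, c i S.card| :=
        Finset.single_le_sum (f := fun S : Finset ℕ => |∑ i ∈ S, c i S.card|)
          (fun _ _ => abs_nonneg _) (Finset.mem_powerset.2 hSk)
    _ ≤ _ := by linarith

/-- Whole time processes are independent over the pairs i ≤ j, and `Sym2.sortEquiv` carries this
over to edges; the different times of one edge stay together in one joint moment. -/
theorem IsWignerProcess.integral_edgeEntry [∀ N, IsProbabilityMeasure (P N)]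
    (hΓ : IsWignerProcess P β R Γ) (N : ℕ) (T : Sym2 (Fin N) → Finset ℕ) :
    Integrable (fun ω => ∏ e, ∏ i ∈ T e, edgeEntry (Γ N) ω e i) (P N) ∧
      ∫ ω, ∏ e, ∏ i ∈ T e, edgeEntry (Γ N) ω e i ∂(P N) =
        ∏ e, edgeMoment (P N) (Γ N) e (T e) := by
  constructor
  · obtain ⟨c, hc⟩ := hΓ.exists_moment_bound
    simp only [Finset.prod_sigma']
    exact integrable_prod_of_moments (X := fun (x : Sigma fun _ : Sym2 (Fin N) => ℕ) ω =>
      edgeEntry (Γ N) ω x.1 x.2) _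
      (fun x => (hΓ.measurable_edgeEntry N x.1 x.2).aestronglyMeasurable)
      fun x n => (hc N x.1 x.2 n).1
  · have h := (hΓ.indep N).precomp Sym2.sortEquiv.injective
    refine h.integral_fun_prod_comp
      (f := fun e (y : ℕ+ → ℝ) => ∏ i ∈ T e, y i.succPNat) (fun e => ?_) fun e => ?_
    · exact (measurable_pi_lambda _ fun k => (hΓ.wigner k).measurable N _ _).aemeasurable
    · exact Measurable.aestronglyMeasurable (by fun_prop)

end WignerProcess

theorem IsIIDDiagonal.integral_prod_pow {Ω : ℕ → Type*} [∀ N, MeasurableSpace (Ω N)]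
    {P : ∀ N, Measure (Ω N)} [∀ N, IsProbabilityMeasure (P N)] {μ : Measure ℝ}
    {lam : ∀ N, Fin N → Ω N → ℝ} (hlam : IsIIDDiagonal P μ lam)
    (hμ : ∀ k : ℕ, Integrable (fun x : ℝ => x ^ k) μ) (N : ℕ) (n : Fin N → ℕ) :
    Integrable (fun ω => ∏ v, lam N v ω ^ n v) (P N) ∧
      ∫ ω, ∏ v, lam N v ω ^ n v ∂(P N) = ∏ v, ∫ x, x ^ n v ∂μ := by
  have hmeas : ∀ v, AEMeasurable (lam N v) (P N) := fun v => (hlam.law N v).aemeasurable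
  have habs : ∀ v k, Integrable (fun ω => |lam N v ω| ^ k) (P N) := by
    intro v k
    have h1 : Integrable (fun x : ℝ => x ^ k) ((P N).map (lam N v)) := by
      rw [(hlam.law N v).map_eq]
      exact hμ k
    have h2 := (h1.comp_aemeasurable (hmeas v)).abs
    simpa only [Function.comp_apply, abs_pow] using h2
  constructor
  · refine integrable_prod_of_moments (X := fun v ω => lam N v ω ^ n v) Finset.univ
      (fun v => ((hmeas v).pow_const _).aestronglyMeasurable) fun v k => ?_
    simp only [abs_pow, ← pow_mul]
    exact habs v _
  · rw [(hlam.indep N).integral_fun_prod_comp (f := fun v x => x ^ n v) hmeas fun v => by fun_prop]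
    refine Finset.prod_congr rfl fun v _ => ?_
    exact (hlam.law N v).integral_comp (f := fun x => x ^ n v) (by fun_prop)

/-- Independence enters three times: between the diagonal and the process, among the diagonal
entries, and among the edges. -/
theorem integral_pathWeight {Ω : ℕ → Type*} [∀ N, MeasurableSpace (Ω N)]
    {P : ∀ N, Measure (Ω N)} [∀ N, IsProbabilityMeasure (P N)]
    {β : ℝ} {R : ℕ+ → ℕ+ → ℝ} {Γ : ∀ N, ℕ+ → Ω N → Matrix (Fin N) (Fin N) ℝ}
    (hΓ : IsWignerProcess P β R Γ) {μ : Measure ℝ}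
    (hμ : ∀ k : ℕ, Integrable (fun x : ℝ => x ^ k) μ)
    {lam : ∀ N, Fin N → Ω N → ℝ} (hlam : IsIIDDiagonal P μ lam)
    (hindep : ∀ N, IndepFun (fun ω (j : Fin N) => lam N j ω)
      (fun ω (k : ℕ+) (i j : Fin N) => Γ N k ω i j) (P N)) (N : ℕ) (p : List (Fin N)) :
    Integrable (fun ω => pathWeight (fun j => lam N j ω) (edgeEntry (Γ N) ω) p) (P N) ∧
      ∫ ω, pathWeight (fun j => lam N j ω) (edgeEntry (Γ N) ω) p ∂(P N) =
        walkValue (fun c => ∫ x, x ^ c ∂μ) (edgeMoment (P N) (Γ N)) p := by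
  obtain ⟨hint1, heq1⟩ := hlam.integral_prod_pow hμ N fun v => p.count v
  obtain ⟨hint2, heq2⟩ := hΓ.integral_edgeEntry N (walkTimes p)
  have hind : IndepFun (fun ω => ∏ v, lam N v ω ^ p.count v)
      (fun ω => ∏ e, ∏ i ∈ walkTimes p e, edgeEntry (Γ N) ω e i) (P N) := by
    refine (hindep N).comp (φ := fun d : Fin N → ℝ => ∏ v, d v ^ p.count v)
      (ψ := fun G : ℕ+ → Fin N → Fin N → ℝ =>
        ∏ e : Sym2 (Fin N), ∏ i ∈ walkTimes p e, G i.succPNat e.inf e.sup) ?_ ?_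
    · fun_prop
    · fun_prop
  refine ⟨hind.integrable_mul hint1 hint2, ?_⟩
  simp only [pathWeight]
  rw [hind.integral_fun_mul_eq_mul_integral hint1.aestronglyMeasurable
    hint2.aestronglyMeasurable, heq1, heq2, walkValue]

/-! ### Mean traces as walk sums and their limits. -/

theorem trace_wignerProduct_integral {Ω : ℕ → Type*} [∀ N, MeasurableSpace (Ω N)]
    {P : ∀ N, Measure (Ω N)} [∀ N, IsProbabilityMeasure (P N)]
    {β : ℝ} {R : ℕ+ → ℕ+ → ℝ} {Γ : ∀ N, ℕ+ → Ω N → Matrix (Fin N) (Fin N) ℝ}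
    (hΓ : IsWignerProcess P β R Γ) {μ : Measure ℝ}
    (hμ : ∀ k : ℕ, Integrable (fun x : ℝ => x ^ k) μ)
    {lam : ∀ N, Fin N → Ω N → ℝ} (hlam : IsIIDDiagonal P μ lam)
    (hindep : ∀ N, IndepFun (fun ω (j : Fin N) => lam N j ω)
      (fun ω (k : ℕ+) (i j : Fin N) => Γ N k ω i j) (P N)) (N k : ℕ) :
    Integrable
      (fun ω => (wignerProduct (fun m => Γ N m ω) (fun j => lam N j ω) k).trace) (P N) ∧
    meanTrace (P N) (Γ N) (lam N) k = (N : ℝ)⁻¹ * ((N : ℝ) ^ (-(k : ℝ) / 2) *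
      ∑ v : Fin N, walkSum (walkValue (fun c => ∫ x, x ^ c ∂μ) (edgeMoment (P N) (Γ N))) v k
        [v]) := by
  have hpath := integral_pathWeight hΓ hμ hlam hindep N
  have hsum := fun v => walkSum_integrable (fun p => (hpath p).1) v k [v]
  have htrace : ∀ ω, (wignerProduct (fun m => Γ N m ω) (fun j => lam N j ω) k).trace =
      (N : ℝ) ^ (-(k : ℝ) / 2) * ∑ v, walkSum
        (pathWeight (fun j => lam N j ω) (edgeEntry (Γ N) ω)) v k [v] := fun ω =>
    trace_wignerProduct _ _ _ (fun i x y => hΓ.edgeEntry_mk N ω x y i) k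
  simp only [meanTrace, htrace]
  refine ⟨(integrable_finsetSum _ fun v _ => (hsum v).1).const_mul _, ?_⟩
  rw [integral_const_mul, integral_finsetSum _ fun v _ => (hsum v).1]
  simp only [(hsum _).2, (hpath _).2]

theorem tendsto_meanTrace {Ω : ℕ → Type*} [∀ N, MeasurableSpace (Ω N)]
    {P : ∀ N, Measure (Ω N)} [∀ N, IsProbabilityMeasure (P N)]
    {β : ℝ} {R : ℕ+ → ℕ+ → ℝ} {r : ℕ → ℝ} {Γ : ∀ N, ℕ+ → Ω N → Matrix (Fin N) (Fin N) ℝ}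
    (hΓ : IsWignerProcess P β R Γ) (hr : IsStationaryCorrelation R r)
    {μ : Measure ℝ} [IsProbabilityMeasure μ]
    (hμ : ∀ k : ℕ, Integrable (fun x : ℝ => x ^ k) μ)
    {lam : ∀ N, Fin N → Ω N → ℝ} (hlam : IsIIDDiagonal P μ lam)
    (hindep : ∀ N, IndepFun (fun ω (j : Fin N) => lam N j ω)
      (fun ω (k : ℕ+) (i j : Fin N) => Γ N k ω i j) (P N)) (k : ℕ) :
    Tendsto (fun N => meanTrace (P N) (Γ N) (lam N) k) atTop
      (𝓝 (if Even k then limitMoment β r μ (k / 2) else 0)) := by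
  have hmom0 : ∫ x, x ^ 0 ∂μ = 1 := by simp
  obtain ⟨B, hB, hκ⟩ := hΓ.exists_edgeMoment_bound k
  -- A walk of k steps has k + 1 vertices with multiplicity, so only moments up to order k + 1
  -- occur.
  set A : ℝ := 1 + ∑ c ∈ Finset.range (k + 2), |∫ x, x ^ c ∂μ| with hAdef
  have hA : 1 ≤ A := le_add_of_nonneg_right (Finset.sum_nonneg fun _ _ => abs_nonneg _)
  have hmom : ∀ c ≤ k + 1, |∫ x, x ^ c ∂μ| ≤ A := by
    intro c hc
    have := Finset.single_le_sum (f := fun c => |∫ x, x ^ c ∂μ|) (fun _ _ => abs_nonneg _)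
      (Finset.mem_range.2 (Nat.lt_succ_of_le hc))
    linarith
  have hw := fun N => hΓ.isEdgeWeight hr N
  have h := tendsto_walkSum (mom := fun c => ∫ x, x ^ c ∂μ) hmom0 k _ hw
    fun N p hp => abs_walkValue_le hA hB hmom0 hmom (hw N).empty (hκ N) p hp
  rw [contourSum_eq_limitMoment] at h
  exact h.congr fun N => ((trace_wignerProduct_integral hΓ hμ hlam hindep N k).2).symm

theorem theorem3 {Ω : ℕ → Type*} [∀ N, MeasurableSpace (Ω N)]
    (P : ∀ N, Measure (Ω N)) [∀ N, IsProbabilityMeasure (P N)]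
    (β : ℝ) (R : ℕ+ → ℕ+ → ℝ) (r : ℕ → ℝ)
    (Γ : ∀ N, ℕ+ → Ω N → Matrix (Fin N) (Fin N) ℝ)
    (hΓ : IsWignerProcess P β R Γ) (hr : IsStationaryCorrelation R r)
    (μ : Measure ℝ) [IsProbabilityMeasure μ]
    (hμ : ∀ k : ℕ, Integrable (fun x : ℝ => x ^ k) μ) (hμ1 : ∫ x, x ∂μ = 1)
    (lam : ∀ N, Fin N → Ω N → ℝ) (hlam : IsIIDDiagonal P μ lam)
    (hindep : ∀ N, IndepFun (fun ω (j : Fin N) => lam N j ω)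
      (fun ω (k : ℕ+) (i j : Fin N) => Γ N k ω i j) (P N)) :
    -- the means exist
    (∀ N k : ℕ, Integrable
      (fun ω => (wignerProduct (fun m => Γ N m ω) (fun j => lam N j ω) k).trace) (P N)) ∧
    -- convergence for odd and for even orders
    (∀ k : ℕ, Tendsto (fun N => meanTrace (P N) (Γ N) (lam N) (2 * k + 1)) atTop (𝓝 0)) ∧
    (∀ k : ℕ, Tendsto (fun N => meanTrace (P N) (Γ N) (lam N) (2 * k)) atTop
      (𝓝 (limitMoment β r μ k))) ∧
    (∀ k : ℕ, wignerWeight β r (k + 1) ≠ 0 →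
      limitMoment β r μ k = 1 / wignerWeight β r (k + 1) *
        ∑ t ∈ PlaneTree.ofOrder (k + 1),
          t.bare (wignerWeight β r) * t.weight (momentWeight μ)) ∧
    -- the generating functions
    ∀ Y ψ : PowerSeries ℝ,
      Y = PowerSeries.X * PowerSeries.mk
        (fun k => wignerWeight β r (k + 1) * limitMoment β r μ k) →
      ψ = PowerSeries.mk (momentWeight μ) →
      PowerSeries.HasSubst Y ∧
      PowerSeries.X * PowerSeries.mk (limitMoment β r μ) =
        PowerSeries.X * PowerSeries.subst Y ψ ∧
      ∀ L : PowerSeries ℝ,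
        (∀ k : ℕ, 1 ≤ k → HasSum (fun m => PowerSeries.coeff m L * (k : ℝ) ^ m)
          ((k : ℝ) * wignerWeight β r k)) →
        (∀ n, Summable fun m => PowerSeries.coeff n (eulerTerm L (PowerSeries.subst Y ψ) m)) ∧
        PowerSeries.derivative ℝ Y = eulerSeries L (PowerSeries.subst Y ψ) := by
  refine ⟨fun N k => (trace_wignerProduct_integral hΓ hμ hlam hindep N k).1, fun k => ?_,
    fun k => ?_, fun k hk => ?_, generating_functions β r μ⟩
  · have h := tendsto_meanTrace hΓ hr hμ hlam hindep (2 * k + 1)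
    rwa [if_neg (by simp [parity_simps])] at h
  · have h := tendsto_meanTrace hΓ hr hμ hlam hindep (2 * k)
    rwa [if_pos (even_two_mul k), Nat.mul_div_cancel_left _ Nat.two_pos] at h
  · rw [limitMoment, Finset.mul_sum]
    refine Finset.sum_congr rfl fun t ht => ?_
    rw [PlaneTree.bare_eq, PlaneTree.mem_ofOrder.1 ht]
    field_simp
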